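/- Let $0<l<u<\infty$, $L>0$, $\tau>0$ and $\alpha\in\mathbb R$. For each $n$ let $\epsilon_{1,n},\dots,\epsilon_{n,n}$ be i.i.d. $\mathcal N(0,1)$ random variables, independent of a standard Brownian motion $W$. For $p=\lfloor\alpha\rfloor$ let $\mathcal C^b(\alpha,L)=\mathcal C^b(\alpha,L,[l,u])$ be the class of all functions $f$ on $[0,1]$ such that $f^{(p)}$ exists on $[0,1]$, $|f^{(p)}(x)-f^{(p)}(y)|\le L|x-y|^{\alpha-p}$ for all $x,y\in[0,1]$, and $l\le f\le u$. Let $\sigma>0$ be an unknown deterministic function on $[0,1]$ with $\sigma^2\in\mathcal C^b(\alpha,L)$. Assume that (a) $\alpha>1/2$ and one observes $Y_{i,n}=\int_0^{i/n}\sigma(s)\,dW_s+\tau\epsilon_{i,n}$, $i=1,\dots,n$; or (b) $\alpha\ge 1$ and one observes $\tilde Y_{i,n}=\sigma(i/n)\,W_{i/n}+\tau\epsilon_{i,n}$, $i=1,\dots,n$. Then there is a constant $C>0$, depending only on $\alpha,L,l,u$ and the known noise level $\tau$, such that $$\liminf_{n\to\infty}\ \inf_{\hat\sigma_n^2}\ \sup_{\sigma^2\in\mathcal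 C^b(\alpha,L)}\ \mathrm E\Big(n^{\frac{\alpha}{2\alpha+1}}\,\big\|\hat\sigma_n^2-\sigma^2\big\|_2^2\Big)\ \ge\ C ,$$ where $\|g\|_2^2=\int_0^1 g(t)^2\,dt$ and the infimum is over all estimators $\hat\sigma_n^2$, i.e. all (jointly measurable) functions of the $n$ observations with values in the functions on $[0,1]$. (Thus the rate of convergence in $L_2$-norm is no better than $n^{-\alpha/(4\alpha+2)}$.) -/

import Mathlib

open MeasureTheory ProbabilityTheory Filter Set Topology
open scoped NNReal ENNReal

namespace VolatilityModel

noncomputable section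

/-! ### Wiener integrals of deterministic integrands -/

/-- A real step function `∑ k, coef k • 1_{(left k, right k]}` on `[0, ∞)`. -/
structure StepFun where
  size : ℕ
  coef : Fin size → ℝ
  left : Fin size → ℝ≥0
  right : Fin size → ℝ≥0
  le : ∀ k, left k ≤ right k

/-- The step function as a function on the time axis. -/
def StepFun.eval (S : StepFun) (s : ℝ) : ℝ :=
  ∑ k, S.coef k * (Ioc (S.left k : ℝ) (S.right k)).indicator (fun _ ↦ (1 : ℝ)) s

/-- The integral `∑ k, coef k * (W (right k) - W (left k))` of a step function against `W`. -/
def StepFun.integral {Ω : Type*} (S : StepFun) (W : ℝ≥0 → Ω → ℝ) (ω : Ω) : ℝ :=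
  ∑ k, S.coef k * (W (S.right k) ω - W (S.left k) ω)

/-- `X` is (a version of) the Wiener integral `∫₀ᵗ g(s) dW_s`: it is the `L²(P)`-limit of the
integrals of step functions which converge to `g 1_{(0,t]}` in `L²(ds)`. -/
def IsWienerIntegral {Ω : Type*} [MeasurableSpace Ω] (W : ℝ≥0 → Ω → ℝ) (P : Measure Ω)
    (g : ℝ → ℝ) (t : ℝ≥0) (X : Ω → ℝ) : Prop :=
  MemLp X 2 P ∧ ∃ S : ℕ → StepFun,
    Tendsto (fun m ↦ eLpNorm (fun s ↦ (S m).eval s - (Ioc (0 : ℝ) t).indicator g s) 2 volume)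
      atTop (𝓝 0) ∧
    Tendsto (fun m ↦ eLpNorm (fun ω ↦ (S m).integral W ω - X ω) 2 P) atTop (𝓝 0)

open Classical in
/-- The Wiener integral `∫₀ᵗ g(s) dW_s` as a random variable. For `W` a Brownian motion and `g`
continuous on `[0,t]` it exists and is unique up to almost sure equality, see
`isWienerIntegral_wienerIntegral` and `IsWienerIntegral.ae_eq`. -/
def wienerIntegral {Ω : Type*} [MeasurableSpace Ω] (W : ℝ≥0 → Ω → ℝ) (P : Measure Ω)
    (g : ℝ → ℝ) (t : ℝ≥0) : Ω → ℝ :=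
  if h : ∃ X, IsWienerIntegral W P g t X then h.choose else 0

section Wellposed

variable {Ω : Type*} [MeasurableSpace Ω] {P : Measure Ω} {W : ℝ≥0 → Ω → ℝ}

theorem integral_sq_sum_increments (hW : IsPreBrownianReal W P) {ι : Type*} [Fintype ι]
    (c : ι → ℝ) (a b : ι → ℝ≥0) (hab : ∀ i, a i ≤ b i) :
    ∫ ω, (∑ i, c i * (W (b i) ω - W (a i) ω)) ^ 2 ∂P =
      ∫ s, (∑ i, c i * (Ioc (a i : ℝ) (b i)).indicator (fun _ ↦ (1 : ℝ)) s) ^ 2 := by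
  have hP : IsProbabilityMeasure P := hW.isGaussianProcess.isProbabilityMeasure
  have hm : ∀ t, MemLp (W t) 2 P := fun t ↦
    (hW.isGaussianProcess.hasGaussianLaw_eval t).memLp_two
  have hmul : ∀ s t, Integrable (fun ω ↦ W s ω * W t ω) P := fun s t ↦ (hm s).integrable_mul (hm t)
  have hcov : ∀ s t, ∫ ω, W s ω * W t ω ∂P = min (s : ℝ) t := fun s t ↦ by
    have h := hW.covariance_eval s t
    rw [covariance_eq_sub (hm s) (hm t), hW.integral_eval, hW.integral_eval] at h
    simpa using h
  have hD : ∀ i, MemLp (fun ω ↦ W (b i) ω - W (a i) ω) 2 P := fun i ↦ (hm _).sub (hm _)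
  have hI : ∀ i : ι, MemLp ((Ioc (a i : ℝ) (b i)).indicator (fun _ ↦ (1 : ℝ))) 2 volume :=
    fun i ↦ memLp_indicator_const 2 measurableSet_Ioc 1 (Or.inr (by simp))
  have hkey : ∀ i j, ∫ ω, (W (b i) ω - W (a i) ω) * (W (b j) ω - W (a j) ω) ∂P =
      ∫ s, (Ioc (a i : ℝ) (b i)).indicator (fun _ ↦ (1 : ℝ)) s *
        (Ioc (a j : ℝ) (b j)).indicator (fun _ ↦ (1 : ℝ)) s := fun i j ↦ by
    have e1 : ∀ ω, (W (b i) ω - W (a i) ω) * (W (b j) ω - W (a j) ω) =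
        (W (b i) ω * W (b j) ω - W (b i) ω * W (a j) ω) -
        (W (a i) ω * W (b j) ω - W (a i) ω * W (a j) ω) := fun ω ↦ by ring
    have e2 : ∀ s, (Ioc (a i : ℝ) (b i)).indicator (fun _ ↦ (1 : ℝ)) s *
        (Ioc (a j : ℝ) (b j)).indicator (fun _ ↦ (1 : ℝ)) s =
        (Ioc (max (a i : ℝ) (a j)) (min (b i : ℝ) (b j))).indicator (fun _ ↦ (1 : ℝ)) s :=
      fun s ↦ by
        simp only [indicator_apply, mem_Ioc, max_lt_iff, le_min_iff]
        split_ifs <;> grind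
    have i1 : ∀ p q r : ℝ≥0, Integrable (fun ω ↦ W p ω * W q ω - W p ω * W r ω) P :=
      fun p q r ↦ (hmul p q).sub (hmul p r)
    simp_rw [e1, e2]
    rw [integral_sub (i1 _ _ _) (i1 _ _ _),
      integral_sub (hmul _ _) (hmul _ _), integral_sub (hmul _ _) (hmul _ _), hcov, hcov, hcov,
      hcov, integral_indicator_const _ measurableSet_Ioc, Real.volume_real_Ioc]
    have h1 : (a i : ℝ) ≤ b i := hab i
    have h2 : (a j : ℝ) ≤ b j := hab j
    simp only [smul_eq_mul, mul_one]
    grind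
  have i2 : ∀ i j, Integrable (fun ω ↦ c i * (W (b i) ω - W (a i) ω) *
      (c j * (W (b j) ω - W (a j) ω))) P := fun i j ↦
    ((hD i).const_mul (c i)).integrable_mul ((hD j).const_mul (c j))
  have i3 : ∀ i j, Integrable (fun s ↦ c i * (Ioc (a i : ℝ) (b i)).indicator (fun _ ↦ (1 : ℝ)) s *
      (c j * (Ioc (a j : ℝ) (b j)).indicator (fun _ ↦ (1 : ℝ)) s)) := fun i j ↦
    ((hI i).const_mul (c i)).integrable_mul ((hI j).const_mul (c j))
  simp_rw [sq, Finset.sum_mul_sum]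
  rw [integral_finsetSum _ (fun i _ ↦ integrable_finsetSum _ fun j _ ↦ i2 i j),
    integral_finsetSum _ (fun i _ ↦ integrable_finsetSum _ fun j _ ↦ i3 i j)]
  refine Finset.sum_congr rfl fun i _ ↦ ?_
  rw [integral_finsetSum _ (fun j _ ↦ i2 i j), integral_finsetSum _ (fun j _ ↦ i3 i j)]
  refine Finset.sum_congr rfl fun j _ ↦ ?_
  simp_rw [mul_mul_mul_comm (c i), integral_const_mul, hkey]

theorem StepFun.memLp_eval (S : StepFun) : MemLp S.eval 2 volume :=
  memLp_finsetSum _ fun k _ ↦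
    (memLp_indicator_const 2 measurableSet_Ioc 1 (Or.inr (by simp))).const_mul _

theorem StepFun.memLp_integral (hW : IsPreBrownianReal W P) (S : StepFun) :
    MemLp (S.integral W) 2 P := by
  have hm : ∀ t, MemLp (W t) 2 P := fun t ↦
    (hW.isGaussianProcess.hasGaussianLaw_eval t).memLp_two
  exact memLp_finsetSum _ fun k _ ↦ ((hm _).sub (hm _)).const_mul _

/-- The Itô isometry for differences of step functions. -/
theorem StepFun.isometry (hW : IsPreBrownianReal W P) (S T : StepFun) :
    eLpNorm (fun ω ↦ S.integral W ω - T.integral W ω) 2 P =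
      eLpNorm (fun s ↦ S.eval s - T.eval s) 2 volume := by
  have h := integral_sq_sum_increments hW (Sum.elim S.coef (fun k ↦ -T.coef k))
    (Sum.elim S.left T.left) (Sum.elim S.right T.right)
    (by rintro (k | k); exacts [S.le k, T.le k])
  simp only [Fintype.sum_sum_type, Sum.elim_inl, Sum.elim_inr, neg_mul, Finset.sum_neg_distrib,
    ← sub_eq_add_neg] at h
  have hST := (S.memLp_integral hW).sub (T.memLp_integral hW)
  have hST' := S.memLp_eval.sub T.memLp_eval
  rw [show (fun ω ↦ S.integral W ω - T.integral W ω) = S.integral W - T.integral W from rfl,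
    show (fun s ↦ S.eval s - T.eval s) = S.eval - T.eval from rfl,
    hST.eLpNorm_eq_integral_rpow_norm two_ne_zero ENNReal.ofNat_ne_top,
    hST'.eLpNorm_eq_integral_rpow_norm two_ne_zero ENNReal.ofNat_ne_top]
  simp only [ENNReal.toReal_ofNat, Real.rpow_ofNat, Real.norm_eq_abs, sq_abs, Pi.sub_apply]
  simp only [StepFun.integral, StepFun.eval]
  rw [h]

/-- Two versions of the Wiener integral agree almost surely. -/
theorem IsWienerIntegral.ae_eq (hW : IsPreBrownianReal W P) {g : ℝ → ℝ} {t : ℝ≥0} {X Y : Ω → ℝ}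
    (hg : AEStronglyMeasurable ((Ioc (0 : ℝ) t).indicator g) volume)
    (hX : IsWienerIntegral W P g t X) (hY : IsWienerIntegral W P g t Y) : X =ᵐ[P] Y := by
  obtain ⟨hXm, S, hS, hSX⟩ := hX
  obtain ⟨hYm, T, hT, hTY⟩ := hY
  set h := (Ioc (0 : ℝ) t).indicator g with hh
  have key : ∀ m, eLpNorm (X - Y) 2 P ≤
      eLpNorm (fun ω ↦ (S m).integral W ω - X ω) 2 P +
      (eLpNorm (fun s ↦ (S m).eval s - h s) 2 volume +
        eLpNorm (fun s ↦ (T m).eval s - h s) 2 volume) +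
      eLpNorm (fun ω ↦ (T m).integral W ω - Y ω) 2 P := fun m ↦ by
    have mS := ((S m).memLp_integral hW).aestronglyMeasurable
    have mT := ((T m).memLp_integral hW).aestronglyMeasurable
    have eS := (S m).memLp_eval.aestronglyMeasurable
    have eT := (T m).memLp_eval.aestronglyMeasurable
    have e : X - Y = (-((S m).integral W - X) + ((S m).integral W - (T m).integral W)) +
        ((T m).integral W - Y) := by abel
    have e' : (S m).eval - (T m).eval = ((S m).eval - h) + (-((T m).eval - h)) := by abel
    rw [e]
    refine (eLpNorm_add_le ((mS.sub hXm.aestronglyMeasurable).neg.add (mS.sub mT))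
      (mT.sub hYm.aestronglyMeasurable) one_le_two).trans ?_
    refine add_le_add ?_ le_rfl
    refine (eLpNorm_add_le (mS.sub hXm.aestronglyMeasurable).neg (mS.sub mT) one_le_two).trans ?_
    rw [eLpNorm_neg]
    refine add_le_add le_rfl ?_
    refine ((S m).isometry hW (T m)).le.trans ?_
    change eLpNorm ((S m).eval - (T m).eval) 2 volume ≤ _
    rw [e']
    refine (eLpNorm_add_le (eS.sub hg) (eT.sub hg).neg one_le_two).trans ?_
    rw [eLpNorm_neg]
    exact le_rfl
  have lim := (hSX.add (hS.add hT)).add hTY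
  simp only [add_zero] at lim
  have h0 : eLpNorm (X - Y) 2 P = 0 := le_antisymm (ge_of_tendsto' lim key) zero_le
  rw [eLpNorm_eq_zero_iff (hXm.sub hYm).aestronglyMeasurable two_ne_zero] at h0
  filter_upwards [h0] with ω hω
  simpa [sub_eq_zero] using hω

/-- The step function with `m` steps on `(0,t]` which interpolates `g` at the right endpoints. -/
def StepFun.riemann (g : ℝ → ℝ) (t : ℝ≥0) (m : ℕ) : StepFun where
  size := m
  coef k := g (t * ((k : ℝ) + 1) / m)
  left k := t * k / m
  right k := t * (k + 1) / m
  le k := by gcongr; simp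

theorem StepFun.riemann_eval_of_notMem (g : ℝ → ℝ) (t : ℝ≥0) (m : ℕ) {s : ℝ}
    (hs : s ∉ Ioc (0 : ℝ) t) : (StepFun.riemann g t m).eval s = 0 := by
  refine Finset.sum_eq_zero fun k _ ↦ ?_
  rw [indicator_of_notMem, mul_zero]
  refine fun h ↦ hs ⟨lt_of_le_of_lt (NNReal.coe_nonneg _) h.1, h.2.trans ?_⟩
  have hk : (k : ℕ) + 1 ≤ m := k.2
  have hk' : ((k : ℕ) : ℝ) + 1 ≤ m := by exact_mod_cast hk
  have hm : (0 : ℝ) < m := by linarith [(Nat.cast_nonneg (k : ℕ) : (0 : ℝ) ≤ _)]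
  simp only [StepFun.riemann, NNReal.coe_div, NNReal.coe_mul, NNReal.coe_add, NNReal.coe_natCast,
    NNReal.coe_one]
  rw [div_le_iff₀ hm]
  gcongr

theorem StepFun.riemann_eval_of_mem (g : ℝ → ℝ) (t : ℝ≥0) {m : ℕ} (hm : 0 < m) {s : ℝ}
    (hs : s ∈ Ioc (0 : ℝ) t) : ∃ r ∈ Icc (0 : ℝ) t, |r - s| ≤ t / m ∧
      (StepFun.riemann g t m).eval s = g r := by
  have ht : (0 : ℝ) < t := hs.1.trans_le hs.2
  have hm' : (0 : ℝ) < m := by exact_mod_cast hm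
  set q : ℕ := ⌈s * m / t⌉₊ with hq
  have hq0 : 0 < q := Nat.ceil_pos.2 (by have := hs.1; positivity)
  have hq1 : q ≤ m := Nat.ceil_le.2 (by
    rw [div_le_iff₀ ht, mul_comm]; exact mul_le_mul_of_nonneg_left hs.2 hm'.le)
  have hle : s * m / t ≤ q := Nat.le_ceil _
  have hlt : (q : ℝ) < s * m / t + 1 := Nat.ceil_lt_add_one (by have := hs.1; positivity)
  have hle' : s ≤ t * q / m := by
    rw [div_le_iff₀ ht] at hle
    rw [le_div_iff₀ hm']; linarith
  have hlt' : t * ((q : ℝ) - 1) / m < s := by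
    have : (q : ℝ) - 1 < s * m / t := by linarith
    rw [lt_div_iff₀ ht] at this
    rw [div_lt_iff₀ hm']; linarith
  refine ⟨t * q / m, ⟨by positivity, ?_⟩, ?_, ?_⟩
  · rw [div_le_iff₀ hm']
    gcongr
  · have : t * ((q : ℝ) - 1) / m = t * q / m - t / m := by ring
    rw [abs_of_nonneg (by linarith)]
    linarith
  · have hqm : q - 1 < m := by omega
    have hcast : ((q - 1 : ℕ) : ℝ) = (q : ℝ) - 1 := by
      rw [Nat.cast_sub hq0]; simp
    refine (Finset.sum_eq_single (⟨q - 1, hqm⟩ : Fin m) ?_ ?_).trans ?_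
    · intro k _ hk
      rw [indicator_of_notMem, mul_zero]
      simp only [StepFun.riemann, NNReal.coe_div, NNReal.coe_mul, NNReal.coe_add,
        NNReal.coe_natCast, NNReal.coe_one, mem_Ioc, not_and, not_le]
      intro h1
      rw [div_lt_iff₀ hm'] at h1
      rw [div_lt_iff₀ hm']
      rw [div_lt_iff₀ hm'] at hlt'
      rw [le_div_iff₀ hm'] at hle'
      have h2 : (k : ℕ) < q := by
        have : (t : ℝ) * (k : ℕ) < t * q := by linarith
        exact_mod_cast lt_of_mul_lt_mul_left this ht.le
      have h3 : (k : ℕ) + 1 < q := by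
        have : (k : ℕ) ≠ q - 1 := fun h ↦ hk (Fin.ext h)
        omega
      have h4 : ((k : ℕ) : ℝ) + 1 ≤ q - 1 := by
        have : (k : ℕ) + 1 + 1 ≤ q := h3
        have : ((k : ℕ) : ℝ) + 1 + 1 ≤ q := by exact_mod_cast this
        linarith
      have := mul_le_mul_of_nonneg_left h4 ht.le
      linarith
    · exact fun h ↦ absurd (Finset.mem_univ (α := Fin m) _) h
    · rw [indicator_of_mem]
      · simp [StepFun.riemann, hcast]
      · simp only [StepFun.riemann, NNReal.coe_div, NNReal.coe_mul, NNReal.coe_add,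
          NNReal.coe_natCast, NNReal.coe_one, hcast, mem_Ioc, sub_add_cancel]
        exact ⟨hlt', hle'⟩

theorem StepFun.tendsto_riemann {g : ℝ → ℝ} {t : ℝ≥0} (hg : ContinuousOn g (Icc 0 (t : ℝ))) :
    Tendsto (fun m ↦ eLpNorm (fun s ↦ (StepFun.riemann g t m).eval s -
      (Ioc (0 : ℝ) t).indicator g s) 2 volume) atTop (𝓝 0) := by
  have huc := isCompact_Icc.uniformContinuousOn_of_continuous hg
  rw [Metric.uniformContinuousOn_iff] at huc
  have hbound : ∀ δ : ℝ, 0 < δ → ∀ᶠ m in atTop, eLpNorm (fun s ↦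
      (StepFun.riemann g t m).eval s - (Ioc (0 : ℝ) t).indicator g s) 2 volume ≤
        ENNReal.ofReal δ * (t : ℝ≥0∞) ^ (1 / 2 : ℝ) := fun δ hδ ↦ by
    obtain ⟨η, hη, H⟩ := huc δ hδ
    have h1 : ∀ᶠ m : ℕ in atTop, (t : ℝ) / m < η :=
      (tendsto_const_div_atTop_nhds_zero_nat (t : ℝ)).eventually_lt_const hη
    filter_upwards [h1, eventually_gt_atTop 0] with m hm hm0
    have hle : ∀ s, ‖(StepFun.riemann g t m).eval s - (Ioc (0 : ℝ) t).indicator g s‖ ≤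
        ‖(Ioc (0 : ℝ) t).indicator (fun _ ↦ δ) s‖ := fun s ↦ by
      by_cases hs : s ∈ Ioc (0 : ℝ) t
      · obtain ⟨r, hr, hrs, he⟩ := StepFun.riemann_eval_of_mem g t hm0 hs
        rw [he, indicator_of_mem hs, indicator_of_mem hs, ← dist_eq_norm, Real.norm_of_nonneg hδ.le]
        exact (H r hr s ⟨hs.1.le, hs.2⟩ (by rw [Real.dist_eq]; linarith)).le
      · simp [indicator_of_notMem hs, StepFun.riemann_eval_of_notMem g t m hs]
    refine (eLpNorm_mono hle).trans ?_
    rw [eLpNorm_indicator_const measurableSet_Ioc two_ne_zero ENNReal.ofNat_ne_top,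
      Real.volume_Ioc, Real.enorm_of_nonneg hδ.le]
    simp
  rw [ENNReal.tendsto_nhds_zero]
  intro e he
  have ht : (t : ℝ≥0∞) ^ (1 / 2 : ℝ) ≠ ∞ := by simp
  have hlim : Tendsto (fun δ : ℝ ↦ ENNReal.ofReal δ * (t : ℝ≥0∞) ^ (1 / 2 : ℝ)) (𝓝[>] 0) (𝓝 0) := by
    have := ENNReal.Tendsto.mul_const (b := (t : ℝ≥0∞) ^ (1 / 2 : ℝ))
      ((ENNReal.continuous_ofReal.tendsto 0).mono_left (nhdsWithin_le_nhds (s := Ioi 0)))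
      (Or.inr ht)
    simpa using this
  obtain ⟨δ, hδ, hδ0⟩ := ((hlim.eventually_le_const he).and self_mem_nhdsWithin).exists
  filter_upwards [hbound δ hδ0] with m hm using hm.trans hδ

/-- Existence of the Wiener integral of an integrand which is continuous on `[0,t]`. -/
theorem exists_isWienerIntegral (hW : IsPreBrownianReal W P) {g : ℝ → ℝ} {t : ℝ≥0}
    (hg : ContinuousOn g (Icc 0 (t : ℝ))) : ∃ X, IsWienerIntegral W P g t X := by
  set S : ℕ → StepFun := fun m ↦ StepFun.riemann g t m with hS
  have hlim : Tendsto (fun m ↦ eLpNorm (fun s ↦ (S m).eval s -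
      (Ioc (0 : ℝ) t).indicator g s) 2 volume) atTop (𝓝 0) := StepFun.tendsto_riemann hg
  have hgm : AEStronglyMeasurable ((Ioc (0 : ℝ) t).indicator g) volume :=
    (aestronglyMeasurable_indicator_iff measurableSet_Ioc).2
      ((hg.mono Ioc_subset_Icc_self).aestronglyMeasurable measurableSet_Ioc)
  set h := (Ioc (0 : ℝ) t).indicator g
  set F : ℕ → Lp ℝ 2 P := fun m ↦ ((S m).memLp_integral hW).toLp _ with hF
  have hdist : ∀ m k, edist (F m) (F k) ≤ eLpNorm (fun s ↦ (S m).eval s - h s) 2 volume +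
      eLpNorm (fun s ↦ (S k).eval s - h s) 2 volume := fun m k ↦ by
    rw [hF, Lp.edist_toLp_toLp]
    refine ((S m).isometry hW (S k)).le.trans ?_
    change eLpNorm ((S m).eval - (S k).eval) 2 volume ≤ _
    have e' : (S m).eval - (S k).eval = ((S m).eval - h) + (-((S k).eval - h)) := by abel
    rw [e']
    refine (eLpNorm_add_le ((S m).memLp_eval.aestronglyMeasurable.sub hgm)
      ((S k).memLp_eval.aestronglyMeasurable.sub hgm).neg one_le_two).trans ?_
    rw [eLpNorm_neg]
    exact le_rfl
  have hcau : CauchySeq F := by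
    rw [EMetric.cauchySeq_iff]
    intro e he
    have he2 : 0 < e / 2 := ENNReal.half_pos he.ne'
    obtain ⟨N, hN⟩ := eventually_atTop.1 (hlim.eventually_lt_const he2)
    refine ⟨N, fun m hm k hk ↦ (hdist m k).trans_lt ?_⟩
    rw [← ENNReal.add_halves e]
    exact ENNReal.add_lt_add (hN m hm) (hN k hk)
  obtain ⟨X, hX⟩ := cauchySeq_tendsto_of_complete hcau
  refine ⟨X, Lp.memLp X, S, hlim, ?_⟩
  rw [tendsto_iff_edist_tendsto_0] at hX
  refine hX.congr fun m ↦ ?_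
  rw [Lp.edist_def]
  refine eLpNorm_congr_ae ?_
  filter_upwards [((S m).memLp_integral hW).coeFn_toLp] with ω hω
  simp [hF, hω]

theorem isWienerIntegral_wienerIntegral (hW : IsPreBrownianReal W P) {g : ℝ → ℝ} {t : ℝ≥0}
    (hg : ContinuousOn g (Icc 0 (t : ℝ))) :
    IsWienerIntegral W P g t (wienerIntegral W P g t) := by
  have h := exists_isWienerIntegral hW hg
  rw [wienerIntegral, dif_pos h]
  exact h.choose_spec

end Wellposed

/-! ### Function class, models and risk -/

/-- The class `C^b(α, L, [l, u])` of functions on `[0,1]`: with `p = ⌊α⌋`, the derivative `f⁽ᵖ⁾`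
exists on `[0,1]` (one-sided at the endpoints) and satisfies
`|f⁽ᵖ⁾(x) - f⁽ᵖ⁾(y)| ≤ L |x - y|^(α - p)`, and `l ≤ f ≤ u`. -/
def boundedHolder (α L l u : ℝ) : Set (ℝ → ℝ) :=
  {f | (∀ k < ⌊α⌋₊, DifferentiableOn ℝ (iteratedDerivWithin k f (Icc 0 1)) (Icc 0 1)) ∧
    (∀ x ∈ Icc (0 : ℝ) 1, ∀ y ∈ Icc (0 : ℝ) 1,
      |iteratedDerivWithin ⌊α⌋₊ f (Icc 0 1) x - iteratedDerivWithin ⌊α⌋₊ f (Icc 0 1) y|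
        ≤ L * |x - y| ^ (α - (⌊α⌋₊ : ℝ))) ∧
    ∀ x ∈ Icc (0 : ℝ) 1, l ≤ f x ∧ f x ≤ u}

/-- The sampling time `i/n`, where the index `i : Fin n` stands for `i + 1 ∈ {1, …, n}`. -/
def obsTime {n : ℕ} (i : Fin n) : ℝ≥0 := ((i : ℕ) + 1 : ℝ≥0) / n

/-- The observations `Y_i = ∫₀^{i/n} σ dW + τ ε_i` with `σ = √f`, `i = 1, …, n`. -/
def obsIntegral {Ω : Type*} [MeasurableSpace Ω] (P : Measure Ω) (W : ℝ≥0 → Ω → ℝ) (τ : ℝ)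
    {n : ℕ} (ε : Fin n → Ω → ℝ) (f : ℝ → ℝ) (ω : Ω) (i : Fin n) : ℝ :=
  wienerIntegral W P (fun s ↦ √(f s)) (obsTime i) ω + τ * ε i ω

/-- The observations `Ỹ_i = σ(i/n) W_{i/n} + τ ε_i` with `σ = √f`, `i = 1, …, n`. -/
def obsProduct {Ω : Type*} (W : ℝ≥0 → Ω → ℝ) (τ : ℝ)
    {n : ℕ} (ε : Fin n → Ω → ℝ) (f : ℝ → ℝ) (ω : Ω) (i : Fin n) : ℝ :=
  √(f (obsTime i)) * W (obsTime i) ω + τ * ε i ω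

/-- The squared loss `‖g - f‖₂² = ∫₀¹ (g(t) - f(t))² dt`. -/
def sqLoss (g f : ℝ → ℝ) : ℝ≥0∞ := ∫⁻ t in Icc (0 : ℝ) 1, ENNReal.ofReal ((g t - f t) ^ 2)

/-- The normalized minimax risk
`inf_T sup_{f ∈ F} E[r ‖T(Y^f) - f‖²_{L²[0,1]}]`, where `Y f` is the vector of the `n` observations
when `σ² = f` is the true function, and `T` runs through all estimators, i.e. all (jointly
measurable) functions of the data with values in the functions on `[0,1]`. -/
def minimaxRisk {Ω : Type*} [MeasurableSpace Ω] (P : Measure Ω) (r : ℝ) (F : Set (ℝ → ℝ)) {n : ℕ}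
    (Y : (ℝ → ℝ) → Ω → Fin n → ℝ) : ℝ≥0∞ :=
  ⨅ (T : (Fin n → ℝ) → ℝ → ℝ) (_ : Measurable (Function.uncurry T)), ⨆ f ∈ F,
    ∫⁻ ω, ENNReal.ofReal r * sqLoss (T (Y f ω)) f ∂P

end

end VolatilityModel

/-! The bound is an Assouad argument. Bumps of height of order `A = c m^(-α)` on `m` intervals of
length `1/m`, added to the constant `l`, span a hypercube inside the class
(`exists_cubeFun_mem_boundedHolder`). If no test separates two vertices that differ in one bump,
every interval forces a loss of order `A²/m`, hence `A²` in total (`le_minimaxRisk_of_two_point`).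

The work lies in showing that neighbours are inseparable. In both models the data have the law of
`a_i ∑_{j ≤ i} s_j z_j + τ e_i` with `(z, e)` standard Gaussian in dimension `2n`
(`lintegral_obs_eq`). No covariance matrix of the data is inverted: the data of the neighbour are
the same map applied to `M (z, e)`, where `M` is lower triangular with unit diagonal
(`obsMap_schemeShift`). Since `det M = 1`, the Kullback-Leibler divergence between the standard
Gaussian law and its image is half the sum of the squared off-diagonal entries of `M`
(`integral_gaussianLogRatio`). A divergence of at most `1/2` makes testing impossible
(`two_point_stdGaussianPi`).

The gain comes from the freedom in `M`. The change of the coefficient of `z_j` in the `i`-th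
observation can be charged to the noise `e_i` or to the Brownian increments up to `i`. With `S` the
total squared perturbation, of order `A²/m`, charging everything to one of them costs order `n S`.
Instead the noise carries a share that falls linearly from one to zero over the lags `i - j` from
`0` to `K`, and the increments carry the rest. The noise then costs `K S` and the increments `n S /
K`; with `K` of order `√n` both are `√n A² / m` (`sum_sq_noiseShift_le`, `sum_sq_signalShift_le`).
Taking `m` of order `n^(1/(4α+2))` keeps this bounded and makes `A²` of order `n^(-α/(2α+1))`
(`exists_bandwidth`). In the product model the perturbation also varies with `i`, which adds a term
of order `A² m`; it is bounded as well. -/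

/-! ### Two-point testing for unipotent transformations of the standard Gaussian measure -/

/-- The standard Gaussian measure on `ι → ℝ`. -/
noncomputable abbrev stdGaussianPi (ι : Type*) [Fintype ι] : Measure (ι → ℝ) :=
  Measure.pi fun _ ↦ gaussianReal 0 1

section GaussianPi

variable {ι : Type*} [Fintype ι]

theorem stdGaussianPi_eq_withDensity :
    stdGaussianPi ι =
      volume.withDensity fun x ↦ ENNReal.ofReal (∏ i, gaussianPDFReal 0 1 (x i)) := by
  refine Measure.pi_eq fun s hs ↦ ?_
  rw [withDensity_apply _ (MeasurableSet.univ_pi hs), volume_pi, Measure.restrict_pi_pi,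
    ← ofReal_integral_eq_lintegral_ofReal, integral_fintype_prod_eq_prod,
    ENNReal.ofReal_prod_of_nonneg]
  · refine Finset.prod_congr rfl fun i _ ↦ ?_
    rw [gaussianReal_apply_eq_integral 0 one_ne_zero]
  · exact fun i _ ↦ integral_nonneg fun x ↦ gaussianPDFReal_nonneg 0 1 x
  · exact Integrable.fintype_prod fun i ↦ (integrable_gaussianPDFReal 0 1).restrict
  · exact ae_of_all _ fun x ↦ Finset.prod_nonneg fun i _ ↦ gaussianPDFReal_nonneg 0 1 _

theorem prod_gaussianPDFReal (x : ι → ℝ) :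
    ∏ i, gaussianPDFReal 0 1 (x i) =
      (√(2 * Real.pi))⁻¹ ^ Fintype.card ι * Real.exp (-(∑ i, x i ^ 2) / 2) := by
  simp only [gaussianPDFReal, NNReal.coe_one, mul_one, sub_zero, Finset.prod_mul_distrib,
    Finset.prod_const, Finset.card_univ, ← Real.exp_sum]
  congr 2
  rw [← Finset.sum_div, Finset.sum_neg_distrib]

theorem integral_sum_mul_sq (c : ι → ℝ) :
    Integrable (fun x : ι → ℝ ↦ (∑ j, c j * x j) ^ 2) (stdGaussianPi ι) ∧
      ∫ x, (∑ j, c j * x j) ^ 2 ∂(stdGaussianPi ι) = ∑ j, c j ^ 2 := by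
  have hm : ∀ j, MemLp (fun x : ℝ ↦ c j * x) 2 (gaussianReal 0 1) := fun j ↦
    (memLp_id_gaussianReal' 2 (by simp)).const_mul (c j)
  have hmp : ∀ j, MemLp (fun x : ι → ℝ ↦ c j * x j) 2 (stdGaussianPi ι) := fun j ↦
    (hm j).comp_measurePreserving (measurePreserving_eval (fun _ : ι ↦ gaussianReal 0 1) j)
  have hs : MemLp (fun x : ι → ℝ ↦ ∑ j, c j * x j) 2 (stdGaussianPi ι) :=
    memLp_finsetSum _ fun j _ ↦ hmp j
  refine ⟨hs.integrable_sq, ?_⟩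
  have h0 : ∫ x, ∑ j, c j * x j ∂(stdGaussianPi ι) = 0 := by
    rw [integral_finsetSum _ fun j _ ↦ (hmp j).integrable one_le_two]
    refine Finset.sum_eq_zero fun j _ ↦ ?_
    rw [integral_const_mul, integral_comp_eval (μ := fun _ : ι ↦ gaussianReal 0 1) (i := j)
      (f := fun y ↦ y) (by fun_prop)]
    simp
  have hv := variance_sum_pi (μ := fun _ : ι ↦ gaussianReal 0 1) (X := fun j x ↦ c j * x) hm
  have e : (∑ i, fun ω : ι → ℝ ↦ c i * ω i) = fun x : ι → ℝ ↦ ∑ j, c j * x j := by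
    ext x; simp
  rw [e, variance_of_integral_eq_zero hs.aemeasurable h0] at hv
  rw [hv]
  refine Finset.sum_congr rfl fun j _ ↦ ?_
  rw [variance_const_mul, variance_fun_id_gaussianReal]
  simp

/-- The log-likelihood ratio between the standard Gaussian measure and its image under a matrix
of determinant one, at the image point. -/
noncomputable def gaussianLogRatio (M : Matrix ι ι ℝ) (x : ι → ℝ) : ℝ :=
  (∑ i, (M.mulVec x) i ^ 2 - ∑ i, x i ^ 2) / 2

theorem measurable_mulVec (M : Matrix ι ι ℝ) : Measurable fun x : ι → ℝ ↦ M.mulVec x := by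
  refine measurable_pi_iff.2 fun i ↦ ?_
  change Measurable fun x : ι → ℝ ↦ ∑ j, M i j * x j
  fun_prop

theorem measurable_gaussianLogRatio (M : Matrix ι ι ℝ) : Measurable (gaussianLogRatio M) := by
  have h := measurable_mulVec M
  unfold gaussianLogRatio; fun_prop

variable [DecidableEq ι]

/-- Lebesgue measure is invariant under a matrix of determinant one, so the change of variables
leaves only the quotient of the Gaussian densities at `M x` and at `x`. -/
theorem lintegral_stdGaussianPi_eq_mulVec {M : Matrix ι ι ℝ} (hM : M.det = 1)
    {F : (ι → ℝ) → ℝ≥0∞} (hF : Measurable F) :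
    ∫⁻ x, F x ∂(stdGaussianPi ι) =
      ∫⁻ x, F (M.mulVec x) * ENNReal.ofReal (Real.exp (-gaussianLogRatio M x))
        ∂(stdGaussianPi ι) := by
  have hmp : Measure.map (fun x ↦ M.mulVec x) volume = volume := by
    have h := Real.map_matrix_volume_pi_eq_smul_volume_pi (M := M) (by simp [hM])
    rw [hM] at h
    simp only [inv_one, abs_one, ENNReal.ofReal_one, one_smul] at h
    exact h
  have hφ : Measurable fun x : ι → ℝ ↦ ENNReal.ofReal (∏ i, gaussianPDFReal 0 1 (x i)) := by
    refine ENNReal.measurable_ofReal.comp (Finset.measurable_fun_prod _ fun i _ ↦ ?_)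
    exact (measurable_gaussianPDFReal 0 1).comp (measurable_pi_apply i)
  have hMm := measurable_mulVec M
  have hV := measurable_gaussianLogRatio M
  rw [stdGaussianPi_eq_withDensity, lintegral_withDensity_eq_lintegral_mul _ hφ hF,
    lintegral_withDensity_eq_lintegral_mul _ hφ (by fun_prop)]
  conv_lhs => rw [← hmp]
  rw [lintegral_map (hφ.mul hF) hMm]
  refine lintegral_congr fun x ↦ ?_
  simp only [Pi.mul_apply]
  have e : ∏ i, gaussianPDFReal 0 1 (M.mulVec x i) =
      (∏ i, gaussianPDFReal 0 1 (x i)) * Real.exp (-gaussianLogRatio M x) := by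
    rw [prod_gaussianPDFReal, prod_gaussianPDFReal, mul_assoc, ← Real.exp_add]
    congr 2
    unfold gaussianLogRatio; ring
  rw [e, ENNReal.ofReal_mul (Finset.prod_nonneg fun i _ ↦ gaussianPDFReal_nonneg 0 1 _)]
  ring

/-- Each coordinate of `M x` is centred with variance the squared norm of a row of `M`. For `det M =
1` the mean is the Kullback-Leibler divergence of the image measure from the standard one. -/
theorem integral_gaussianLogRatio (M : Matrix ι ι ℝ) :
    Integrable (gaussianLogRatio M) (stdGaussianPi ι) ∧
      ∫ x, gaussianLogRatio M x ∂(stdGaussianPi ι) =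
        (∑ i, ∑ j, M i j ^ 2 - Fintype.card ι) / 2 := by
  have h1 := fun i ↦ integral_sum_mul_sq (M i)
  have h2 : ∀ i : ι, Integrable (fun x : ι → ℝ ↦ x i ^ 2) (stdGaussianPi ι) ∧
      ∫ x, x i ^ 2 ∂(stdGaussianPi ι) = 1 := fun i ↦ by
    have := integral_sum_mul_sq (Pi.single i (1 : ℝ))
    simpa [Pi.single_apply, ite_pow] using this
  have i1 : Integrable (fun x : ι → ℝ ↦ ∑ i, (M.mulVec x) i ^ 2) (stdGaussianPi ι) :=
    integrable_finsetSum _ fun i _ ↦ (h1 i).1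
  have i2 : Integrable (fun x : ι → ℝ ↦ ∑ i, x i ^ 2) (stdGaussianPi ι) :=
    integrable_finsetSum _ fun i _ ↦ (h2 i).1
  refine ⟨(i1.sub i2).div_const 2, ?_⟩
  simp only [gaussianLogRatio]
  rw [integral_div, integral_sub i1 i2, integral_finsetSum _ fun i _ ↦ (h2 i).1,
    integral_finsetSum _ fun i _ ↦ by simpa [Matrix.mulVec, dotProduct] using (h1 i).1]
  simp only [Matrix.mulVec, dotProduct, (h1 _).2, (h2 _).2]
  simp

/-- With `s = exp (-v/2)`, the left side is at most `s`, the geometric mean of the minimum and the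
maximum of `1` and `s²`. The weighted inequality `√(ab) ≤ 2a + b/8` and `min + max = 1 + s²` give
the right side. After integration this trades divergence for affinity. -/
theorem one_sub_half_le_min_exp (v : ℝ) :
    1 - v / 2 ≤ 15 / 8 * min 1 (Real.exp (-v)) + (1 + Real.exp (-v)) / 8 := by
  have h1 := Real.add_one_le_exp (-(v / 2))
  have h2 : Real.exp (-v) = Real.exp (-(v / 2)) ^ 2 := by
    rw [← Real.exp_nat_mul]; congr 1; push_cast; ring
  rw [h2]
  set s := Real.exp (-(v / 2))
  rcases min_cases 1 (s ^ 2) with ⟨h, _⟩ | ⟨h, _⟩ <;> rw [h]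
  · nlinarith [sq_nonneg (s - 4)]
  · nlinarith [sq_nonneg (s - 1 / 4)]

/-- The affinity of the standard Gaussian measure with its image under a matrix of determinant one
is bounded below when the Kullback-Leibler divergence is at most `1/2`. -/
theorem quarter_le_integral_min_exp {M : Matrix ι ι ℝ} (hM : M.det = 1)
    (hn : ∑ i, ∑ j, M i j ^ 2 ≤ Fintype.card ι + 1) :
    1 / 4 ≤ ∫ x, min 1 (Real.exp (-gaussianLogRatio M x)) ∂(stdGaussianPi ι) := by
  have hV := measurable_gaussianLogRatio M
  obtain ⟨iV, eV⟩ := integral_gaussianLogRatio M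
  have hl : ∫⁻ x, ENNReal.ofReal (Real.exp (-gaussianLogRatio M x)) ∂(stdGaussianPi ι) = 1 := by
    have := lintegral_stdGaussianPi_eq_mulVec hM (F := fun _ ↦ 1) measurable_const
    simpa using this.symm
  have iE : Integrable (fun x ↦ Real.exp (-gaussianLogRatio M x)) (stdGaussianPi ι) := by
    refine (lintegral_ofReal_ne_top_iff_integrable (by fun_prop)
      (ae_of_all _ fun x ↦ (Real.exp_pos _).le)).1 ?_
    rw [hl]; simp
  have eE : ∫ x, Real.exp (-gaussianLogRatio M x) ∂(stdGaussianPi ι) = 1 := by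
    rw [integral_eq_lintegral_of_nonneg_ae (ae_of_all _ fun x ↦ (Real.exp_pos _).le)
      (by fun_prop), hl]
    simp
  have iMin : Integrable (fun x ↦ min 1 (Real.exp (-gaussianLogRatio M x))) (stdGaussianPi ι) :=
    (integrable_const (1 : ℝ)).inf iE
  -- The log ratio has mean at most `1/2` and its negative exponential has mean one, so the affinity
  -- is at least `(3/4 - 1/4) · 8/15 = 4/15`.
  have key := integral_mono (μ := stdGaussianPi ι)
    (f := fun x ↦ 1 - gaussianLogRatio M x / 2)
    (g := fun x ↦ 15 / 8 * min 1 (Real.exp (-gaussianLogRatio M x)) +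
      (1 + Real.exp (-gaussianLogRatio M x)) / 8)
    ((integrable_const (1 : ℝ)).sub (iV.div_const 2))
    ((iMin.const_mul _).add (((integrable_const (1 : ℝ)).add iE).div_const 8))
    (fun x ↦ one_sub_half_le_min_exp _)
  have i1E : Integrable (fun x ↦ 1 + Real.exp (-gaussianLogRatio M x)) (stdGaussianPi ι) :=
    (integrable_const (1 : ℝ)).add iE
  rw [integral_sub (integrable_const (1 : ℝ)) (iV.div_const 2), integral_div, eV,
    integral_add (iMin.const_mul _) (i1E.div_const 8),
    integral_const_mul, integral_div, integral_add (integrable_const (1 : ℝ)) iE, eE] at key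
  simp only [integral_const, probReal_univ, smul_eq_mul, mul_one] at key
  linarith

/-- Le Cam's two-point bound: written at the point `M x`, both integrals run over the same measure
with densities `exp (-V)` and `1`, and the smaller density is common to both. -/
theorem two_point_stdGaussianPi {M : Matrix ι ι ℝ} (hM : M.det = 1)
    (hn : ∑ i, ∑ j, M i j ^ 2 ≤ Fintype.card ι + 1)
    {a b : (ι → ℝ) → ℝ≥0∞} (ha : Measurable a) (hb : Measurable b) {D : ℝ≥0∞}
    (hD : ∀ x, D ≤ a x + b x) :
    D * ENNReal.ofReal (1 / 4) ≤
      ∫⁻ x, a x ∂(stdGaussianPi ι) + ∫⁻ x, b (M.mulVec x) ∂(stdGaussianPi ι) := by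
  have hV := measurable_gaussianLogRatio M
  have hMm := measurable_mulVec M
  have hmin : ∀ x, 0 ≤ min 1 (Real.exp (-gaussianLogRatio M x)) := fun x ↦
    le_min zero_le_one (Real.exp_pos _).le
  calc D * ENNReal.ofReal (1 / 4)
      ≤ D * ∫⁻ x, ENNReal.ofReal (min 1 (Real.exp (-gaussianLogRatio M x)))
          ∂(stdGaussianPi ι) := by
        gcongr
        rw [← ofReal_integral_eq_lintegral_ofReal]
        · exact ENNReal.ofReal_le_ofReal (quarter_le_integral_min_exp hM hn)
        · refine Integrable.of_bound (by fun_prop) 1 (ae_of_all _ fun x ↦ ?_)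
          rw [Real.norm_of_nonneg (hmin x)]
          exact min_le_left _ _
        · exact ae_of_all _ hmin
    _ = ∫⁻ x, D * ENNReal.ofReal (min 1 (Real.exp (-gaussianLogRatio M x)))
          ∂(stdGaussianPi ι) := (lintegral_const_mul _ (by fun_prop)).symm
    _ ≤ ∫⁻ x, (a (M.mulVec x) * ENNReal.ofReal (Real.exp (-gaussianLogRatio M x)) +
          b (M.mulVec x)) ∂(stdGaussianPi ι) := by
        refine lintegral_mono fun x ↦ ?_
        refine (mul_le_mul_left (hD (M.mulVec x)) _).trans ?_
        rw [add_mul]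
        refine add_le_add (mul_le_mul_right (ENNReal.ofReal_le_ofReal (min_le_right _ _)) _) ?_
        refine (mul_le_mul_right (ENNReal.ofReal_le_ofReal (min_le_left _ _)) _).trans ?_
        simp
    _ = _ := by
        have hbM : Measurable fun x ↦ b (M.mulVec x) := hb.comp hMm
        rw [lintegral_add_right _ hbM, lintegral_stdGaussianPi_eq_mulVec hM ha]

end GaussianPi

/-! ### The joint law of Wiener integrals and an independent noise vector -/

section L2Limits

theorem norm_cexp_mul_I_sub_le (a b : ℝ) :
    ‖Complex.exp (a * Complex.I) - Complex.exp (b * Complex.I)‖ ≤ |a - b| := by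
  have e : Complex.exp (a * Complex.I) - Complex.exp (b * Complex.I) =
      Complex.exp (b * Complex.I) * (Complex.exp (Complex.I * ((a - b : ℝ) : ℂ)) - 1) := by
    rw [mul_sub, ← Complex.exp_add, mul_one]; congr 2; push_cast; ring
  rw [e, norm_mul, Complex.norm_exp_ofReal_mul_I, one_mul]
  exact Real.norm_exp_I_mul_ofReal_sub_one_le

/-- The map `x ↦ exp (i x)` is 1-Lipschitz, so `L²` convergence passes to characteristic functions;
the fixed summand `Y` cancels in the difference. -/
theorem tendsto_integral_cexp_add {Ω : Type*} [MeasurableSpace Ω] {P : Measure Ω}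
    [IsProbabilityMeasure P] {T : ℕ → Ω → ℝ} {X Y : Ω → ℝ} (hT : ∀ m, AEMeasurable (T m) P)
    (hX : AEMeasurable X P) (hY : AEMeasurable Y P)
    (h : Tendsto (fun m ↦ eLpNorm (fun ω ↦ T m ω - X ω) 2 P) atTop (𝓝 0)) :
    Tendsto (fun m ↦ ∫ ω, Complex.exp ((T m ω + Y ω : ℝ) * Complex.I) ∂P) atTop
      (𝓝 (∫ ω, Complex.exp ((X ω + Y ω : ℝ) * Complex.I) ∂P)) := by
  have hint : ∀ Z : Ω → ℝ, AEMeasurable Z P →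
      Integrable (fun ω ↦ Complex.exp ((Z ω : ℝ) * Complex.I)) P := fun Z hZ ↦
    Integrable.of_bound (by fun_prop) 1 (ae_of_all _ fun ω ↦
      (Complex.norm_exp_ofReal_mul_I _).le)
  refine tendsto_integral_of_L1' _ (hint _ (hX.add hY)).aestronglyMeasurable
    (Eventually.of_forall fun m ↦ hint _ ((hT m).add hY)) ?_
  refine tendsto_of_tendsto_of_tendsto_of_le_of_le tendsto_const_nhds h (fun m ↦ zero_le)
    fun m ↦ ?_
  refine (eLpNorm_mono (g := fun ω ↦ T m ω - X ω) fun ω ↦ ?_).trans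
    (eLpNorm_le_eLpNorm_of_exponent_le one_le_two
      ((hT m).sub hX).aestronglyMeasurable)
  refine (norm_cexp_mul_I_sub_le _ _).trans ?_
  simp

theorem integral_sq_eq_eLpNorm_sq {α : Type*} [MeasurableSpace α] {μ : Measure α} {f : α → ℝ}
    (hf : MemLp f 2 μ) : ∫ x, f x ^ 2 ∂μ = (eLpNorm f 2 μ).toReal ^ 2 := by
  rw [hf.eLpNorm_eq_integral_rpow_norm two_ne_zero ENNReal.ofNat_ne_top]
  simp only [ENNReal.toReal_ofNat, Real.rpow_ofNat, Real.norm_eq_abs, sq_abs]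
  have h0 : 0 ≤ ∫ x, f x ^ 2 ∂μ := integral_nonneg fun x ↦ sq_nonneg _
  rw [ENNReal.toReal_ofReal (by positivity), ← Real.rpow_natCast, ← Real.rpow_mul h0]
  norm_num

theorem tendsto_integral_sq_of_eLpNorm {α : Type*} [MeasurableSpace α] {μ : Measure α}
    {f : ℕ → α → ℝ} {g : α → ℝ} (hf : ∀ m, MemLp (f m) 2 μ) (hg : MemLp g 2 μ)
    (h : Tendsto (fun m ↦ eLpNorm (fun x ↦ f m x - g x) 2 μ) atTop (𝓝 0)) :
    Tendsto (fun m ↦ ∫ x, f m x ^ 2 ∂μ) atTop (𝓝 (∫ x, g x ^ 2 ∂μ)) := by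
  have h1 := (Lp.tendsto_Lp_iff_tendsto_eLpNorm'' f hf g hg).2 h
  have h2 := (h1.norm).pow 2
  simpa only [Lp.norm_toLp, ← integral_sq_eq_eLpNorm_sq (hf _),
    ← integral_sq_eq_eLpNorm_sq hg] using h2

end L2Limits

/-! ### Limits of step-function integrals: linearity and characteristic functions. -/

namespace VolatilityModel

section StepLimits

variable {Ω : Type*} {W : ℝ≥0 → Ω → ℝ}

/-- The sum of two step functions. -/
def StepFun.add (S T : StepFun) : StepFun where
  size := S.size + T.size
  coef := Fin.append S.coef T.coef
  left := Fin.append S.left T.left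
  right := Fin.append S.right T.right
  le k := by
    refine Fin.addCases (fun i ↦ ?_) (fun i ↦ ?_) k
    · simpa using S.le i
    · simpa using T.le i

/-- A scalar multiple of a step function. -/
def StepFun.smul (c : ℝ) (S : StepFun) : StepFun where
  size := S.size
  coef k := c * S.coef k
  left := S.left
  right := S.right
  le := S.le

/-- The step function with no steps. -/
def StepFun.zero : StepFun where
  size := 0
  coef := Fin.elim0
  left := Fin.elim0
  right := Fin.elim0
  le := fun k ↦ k.elim0

theorem StepFun.eval_add (S T : StepFun) (s : ℝ) : (S.add T).eval s = S.eval s + T.eval s := by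
  refine (Fin.sum_univ_add (a := S.size) (b := T.size) _).trans ?_
  simp [StepFun.eval, StepFun.add]

theorem StepFun.integral_add (S T : StepFun) (ω : Ω) :
    (S.add T).integral W ω = S.integral W ω + T.integral W ω := by
  refine (Fin.sum_univ_add (a := S.size) (b := T.size) _).trans ?_
  simp [StepFun.integral, StepFun.add]

theorem StepFun.eval_smul (c : ℝ) (S : StepFun) (s : ℝ) : (S.smul c).eval s = c * S.eval s := by
  simp only [StepFun.eval, StepFun.smul, Finset.mul_sum, mul_assoc]; rfl

theorem StepFun.integral_smul (c : ℝ) (S : StepFun) (ω : Ω) :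
    (S.smul c).integral W ω = c * S.integral W ω := by
  simp only [StepFun.integral, StepFun.smul, Finset.mul_sum, mul_assoc]; rfl

variable [MeasurableSpace Ω] {P : Measure Ω}

/-- `X` is the `L²`-limit of integrals of step functions which converge to `G` in `L²`. -/
def IsStepLimit (W : ℝ≥0 → Ω → ℝ) (P : Measure Ω) (G : ℝ → ℝ) (X : Ω → ℝ) : Prop :=
  MemLp G 2 volume ∧ MemLp X 2 P ∧ ∃ S : ℕ → StepFun,
    Tendsto (fun m ↦ eLpNorm (fun s ↦ (S m).eval s - G s) 2 volume) atTop (𝓝 0) ∧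
    Tendsto (fun m ↦ eLpNorm (fun ω ↦ (S m).integral W ω - X ω) 2 P) atTop (𝓝 0)

theorem tendsto_eLpNorm_add_sub {α : Type*} [MeasurableSpace α] {μ : Measure α}
    {f g : ℕ → α → ℝ} {F G : α → ℝ} (hf : ∀ m, MemLp (f m) 2 μ) (hg : ∀ m, MemLp (g m) 2 μ)
    (hF : MemLp F 2 μ) (hG : MemLp G 2 μ)
    (h1 : Tendsto (fun m ↦ eLpNorm (fun x ↦ f m x - F x) 2 μ) atTop (𝓝 0))
    (h2 : Tendsto (fun m ↦ eLpNorm (fun x ↦ g m x - G x) 2 μ) atTop (𝓝 0)) :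
    Tendsto (fun m ↦ eLpNorm (fun x ↦ f m x + g m x - (F x + G x)) 2 μ) atTop (𝓝 0) := by
  have h := h1.add h2
  rw [add_zero] at h
  refine tendsto_of_tendsto_of_tendsto_of_le_of_le tendsto_const_nhds h (fun m ↦ zero_le)
    fun m ↦ ?_
  have e : (fun x ↦ f m x + g m x - (F x + G x)) = (f m - F) + (g m - G) := by
    ext x; simp only [Pi.add_apply, Pi.sub_apply]; ring
  rw [e]
  exact eLpNorm_add_le ((hf m).sub hF).aestronglyMeasurable ((hg m).sub hG).aestronglyMeasurable
    one_le_two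

theorem tendsto_eLpNorm_const_mul_sub {α : Type*} [MeasurableSpace α] {μ : Measure α}
    {f : ℕ → α → ℝ} {F : α → ℝ} (c : ℝ)
    (h : Tendsto (fun m ↦ eLpNorm (fun x ↦ f m x - F x) 2 μ) atTop (𝓝 0)) :
    Tendsto (fun m ↦ eLpNorm (fun x ↦ c * f m x - c * F x) 2 μ) atTop (𝓝 0) := by
  have h' := ENNReal.Tendsto.const_mul (a := ‖c‖ₑ) h (Or.inr enorm_ne_top)
  rw [mul_zero] at h'
  refine h'.congr fun m ↦ ?_
  rw [← eLpNorm_const_smul]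
  congr 1; ext x; simp [mul_sub]

theorem IsStepLimit.zero : IsStepLimit W P (fun _ ↦ 0) (fun _ ↦ 0) := by
  refine ⟨MemLp.zero, MemLp.zero, fun _ ↦ StepFun.zero, ?_, ?_⟩ <;>
    simp [StepFun.zero, StepFun.eval, StepFun.integral]

theorem IsStepLimit.add (hW : IsPreBrownianReal W P) {G H : ℝ → ℝ} {X Y : Ω → ℝ}
    (hX : IsStepLimit W P G X) (hY : IsStepLimit W P H Y) :
    IsStepLimit W P (fun s ↦ G s + H s) (fun ω ↦ X ω + Y ω) := by
  obtain ⟨hG, hXm, S, hS1, hS2⟩ := hX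
  obtain ⟨hH, hYm, T, hT1, hT2⟩ := hY
  refine ⟨hG.add hH, hXm.add hYm, fun m ↦ (S m).add (T m), ?_, ?_⟩
  · simp only [StepFun.eval_add]
    exact tendsto_eLpNorm_add_sub (fun m ↦ (S m).memLp_eval) (fun m ↦ (T m).memLp_eval) hG hH
      hS1 hT1
  · simp only [StepFun.integral_add]
    exact tendsto_eLpNorm_add_sub (fun m ↦ (S m).memLp_integral hW)
      (fun m ↦ (T m).memLp_integral hW) hXm hYm hS2 hT2

theorem IsStepLimit.const_mul (c : ℝ) {G : ℝ → ℝ} {X : Ω → ℝ} (hX : IsStepLimit W P G X) :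
    IsStepLimit W P (fun s ↦ c * G s) (fun ω ↦ c * X ω) := by
  obtain ⟨hG, hXm, S, hS1, hS2⟩ := hX
  refine ⟨hG.const_mul c, hXm.const_mul c, fun m ↦ (S m).smul c, ?_, ?_⟩
  · simp only [StepFun.eval_smul]
    exact tendsto_eLpNorm_const_mul_sub c hS1
  · simp only [StepFun.integral_smul]
    exact tendsto_eLpNorm_const_mul_sub c hS2

theorem IsStepLimit.sum (hW : IsPreBrownianReal W P) {ι : Type*} (s : Finset ι)
    {G : ι → ℝ → ℝ} {X : ι → Ω → ℝ} (hX : ∀ i ∈ s, IsStepLimit W P (G i) (X i)) :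
    IsStepLimit W P (fun x ↦ ∑ i ∈ s, G i x) (fun ω ↦ ∑ i ∈ s, X i ω) := by
  classical
  induction s using Finset.induction_on with
  | empty => simpa using IsStepLimit.zero
  | insert a s ha ih =>
    simp only [Finset.sum_insert ha]
    exact (hX a (by simp)).add hW (ih fun i hi ↦ hX i (by simp [hi]))

/-- The intervals may overlap, so independence of increments is not available. The sum is Gaussian
as a linear combination of values of `W`, and the isometry gives its variance. -/
theorem hasLaw_sum_increments (hW : IsPreBrownianReal W P) {ι : Type*} [Fintype ι]
    (c : ι → ℝ) (a b : ι → ℝ≥0) (hab : ∀ i, a i ≤ b i) :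
    P.map (fun ω ↦ ∑ i, c i * (W (b i) ω - W (a i) ω)) = gaussianReal 0
      (∫ s, (∑ i, c i * (Ioc (a i : ℝ) (b i)).indicator (fun _ ↦ (1 : ℝ)) s) ^ 2).toNNReal := by
  have hP : IsProbabilityMeasure P := hW.isGaussianProcess.isProbabilityMeasure
  have hm : ∀ t, MemLp (W t) 2 P := fun t ↦
    (hW.isGaussianProcess.hasGaussianLaw_eval t).memLp_two
  have hproc : IsGaussianProcess (fun (i : ι ⊕ ι) ω ↦
      Sum.elim c (fun i ↦ -c i) i • W (Sum.elim b a i) ω) P :=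
    (hW.isGaussianProcess.comp_right (Sum.elim b a)).smul (Sum.elim c fun i ↦ -c i)
  have hG := hproc.hasGaussianLaw_fun_sum (I := Finset.univ)
  have e : (fun ω ↦ ∑ i : ι ⊕ ι, Sum.elim c (fun i ↦ -c i) i • W (Sum.elim b a i) ω) =
      fun ω ↦ ∑ i, c i * (W (b i) ω - W (a i) ω) := by
    ext ω
    rw [Fintype.sum_sum_type, ← Finset.sum_add_distrib]
    refine Finset.sum_congr rfl fun i _ ↦ ?_
    simp; ring
  rw [e] at hG
  have h0 : ∫ ω, ∑ i, c i * (W (b i) ω - W (a i) ω) ∂P = 0 := by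
    have hi : ∀ i, Integrable (fun ω ↦ c i * (W (b i) ω - W (a i) ω)) P := fun i ↦
      (((hm _).sub (hm _)).integrable one_le_two).const_mul _
    rw [integral_finsetSum _ fun i _ ↦ hi i]
    refine Finset.sum_eq_zero fun i _ ↦ ?_
    rw [integral_const_mul, integral_sub ((hm _).integrable one_le_two)
      ((hm _).integrable one_le_two), hW.integral_eval, hW.integral_eval]
    simp
  rw [hG.map_eq_gaussianReal, h0, variance_of_integral_eq_zero hG.aemeasurable h0,
    integral_sq_sum_increments hW c a b hab]

/-- Frequency one is enough: every other frequency can be absorbed into the coefficients of `S` and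
into `Y`. -/
theorem StepFun.integral_cexp_add (hW : IsPreBrownianReal W P) (S : StepFun) {Y : Ω → ℝ}
    (hY : AEMeasurable Y P) (hWY : IndepFun (fun ω t ↦ W t ω) Y P) :
    ∫ ω, Complex.exp ((S.integral W ω + Y ω : ℝ) * Complex.I) ∂P =
      Complex.exp (-((∫ s, S.eval s ^ 2 : ℝ) : ℂ) / 2) *
        ∫ ω, Complex.exp ((Y ω : ℝ) * Complex.I) ∂P := by
  have hP : IsProbabilityMeasure P := hW.isGaussianProcess.isProbabilityMeasure
  have hS : AEMeasurable (S.integral W) P := (S.memLp_integral hW).aemeasurable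
  have hind : IndepFun (S.integral W) Y P := by
    have hφ : Measurable fun w : ℝ≥0 → ℝ ↦ ∑ k, S.coef k * (w (S.right k) - w (S.left k)) := by
      fun_prop
    exact hWY.comp hφ measurable_id
  have hlaw := hasLaw_sum_increments hW S.coef S.left S.right S.le
  have h1 : ∫ ω, Complex.exp ((S.integral W ω : ℝ) * Complex.I) ∂P =
      Complex.exp (-((∫ s, S.eval s ^ 2 : ℝ) : ℂ) / 2) := by
    have := charFun_gaussianReal (μ := 0) (v := (∫ s, S.eval s ^ 2).toNNReal) 1
    rw [show gaussianReal 0 (∫ s, S.eval s ^ 2).toNNReal = P.map (S.integral W) from hlaw.symm,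
      charFun_apply_real, integral_map hS (by fun_prop)] at this
    simp only [Complex.ofReal_one, one_mul] at this
    rw [this, Real.coe_toNNReal _ (integral_nonneg fun s ↦ sq_nonneg _)]
    congr 1; simp; ring
  rw [← h1]
  have h2 := hind.integral_fun_comp_mul_comp (f := fun x : ℝ ↦ Complex.exp (x * Complex.I))
    (g := fun x : ℝ ↦ Complex.exp (x * Complex.I)) hS hY (by fun_prop) (by fun_prop)
  rw [← h2]
  refine integral_congr_ae (ae_of_all _ fun ω ↦ ?_)
  simp only [← Complex.exp_add]; congr 1; push_cast; ring

theorem IsStepLimit.integral_cexp_add (hW : IsPreBrownianReal W P) {G : ℝ → ℝ} {X Y : Ω → ℝ}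
    (hX : IsStepLimit W P G X) (hY : AEMeasurable Y P) (hWY : IndepFun (fun ω t ↦ W t ω) Y P) :
    ∫ ω, Complex.exp ((X ω + Y ω : ℝ) * Complex.I) ∂P =
      Complex.exp (-((∫ s, G s ^ 2 : ℝ) : ℂ) / 2) *
        ∫ ω, Complex.exp ((Y ω : ℝ) * Complex.I) ∂P := by
  have hP : IsProbabilityMeasure P := hW.isGaussianProcess.isProbabilityMeasure
  obtain ⟨hG, hXm, S, hS1, hS2⟩ := hX
  have l1 := tendsto_integral_cexp_add (fun m ↦ ((S m).memLp_integral hW).aemeasurable)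
    hXm.aemeasurable hY hS2
  have l2 := tendsto_integral_sq_of_eLpNorm (fun m ↦ (S m).memLp_eval) hG hS1
  refine tendsto_nhds_unique l1 ?_
  simp only [fun m ↦ (S m).integral_cexp_add hW hY hWY]
  refine Tendsto.mul_const _ ?_
  refine (Complex.continuous_exp.tendsto _).comp ?_
  exact ((Complex.continuous_ofReal.tendsto _).comp l2).neg.div_const 2

/-- Orthonormal step limits and an independent standard Gaussian vector have jointly the standard
Gaussian law. -/
theorem map_sumElim_eq_stdGaussianPi (hW : IsPreBrownianReal W P) {n : ℕ}
    {G : Fin n → ℝ → ℝ} {Z : Fin n → Ω → ℝ} {ε : Fin n → Ω → ℝ}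
    (hZ : ∀ j, IsStepLimit W P (G j) (Z j))
    (hG : ∀ c : Fin n → ℝ, ∫ s, (∑ j, c j * G j s) ^ 2 = ∑ j, c j ^ 2)
    (hε : ∀ i, HasLaw (ε i) (gaussianReal 0 1) P) (hi : iIndepFun ε P)
    (hind : IndepFun (fun ω t ↦ W t ω) (fun ω i ↦ ε i ω) P) :
    P.map (fun ω ↦ (Sum.elim (fun j ↦ Z j ω) (fun i ↦ ε i ω) : Fin n ⊕ Fin n → ℝ)) =
      stdGaussianPi (Fin n ⊕ Fin n) := by
  have hP : IsProbabilityMeasure P := hW.isGaussianProcess.isProbabilityMeasure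
  have hZm : ∀ j, AEMeasurable (Z j) P := fun j ↦ (hZ j).2.1.aemeasurable
  have hεm : ∀ i, AEMeasurable (ε i) P := fun i ↦ (hε i).aemeasurable
  have hm : AEMeasurable (fun ω ↦ (Sum.elim (fun j ↦ Z j ω) (fun i ↦ ε i ω) :
      Fin n ⊕ Fin n → ℝ)) P := by
    refine aemeasurable_pi_iff.2 ?_
    rintro (j | i)
    exacts [hZm j, hεm i]
  have hPm : IsProbabilityMeasure (P.map (fun ω ↦
      (Sum.elim (fun j ↦ Z j ω) (fun i ↦ ε i ω) : Fin n ⊕ Fin n → ℝ))) :=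
    Measure.isProbabilityMeasure_map hm
  refine charFun_eq_pi_iff.1 fun t ↦ ?_
  have hεlaw : P.map (fun ω i ↦ ε i ω) = Measure.pi fun _ : Fin n ↦ gaussianReal 0 1 := by
    rw [(iIndepFun_iff_map_fun_eq_pi_map hεm).1 hi]
    simp only [(hε _).map_eq]
  have hεP : IsProbabilityMeasure (P.map (fun ω i ↦ ε i ω)) :=
    Measure.isProbabilityMeasure_map (aemeasurable_pi_iff.2 hεm)
  have hεc := charFun_eq_pi_iff.2 hεlaw (WithLp.toLp 2 fun i ↦ t (Sum.inr i))
  rw [charFun_apply, integral_map (by fun_prop) (by fun_prop),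
    integral_map (aemeasurable_pi_iff.2 hεm) (by fun_prop)] at hεc
  -- The frequencies enter as coefficients, so the joint characteristic function at `t` is that of
  -- one step limit plus one independent noise term at frequency one.
  have hlim := IsStepLimit.sum hW Finset.univ fun j _ ↦ (hZ j).const_mul (t (Sum.inl j))
  have hY : AEMeasurable (fun ω ↦ ∑ i, t (Sum.inr i) * ε i ω) P :=
    Finset.aemeasurable_fun_sum _ fun i _ ↦ (hεm i).const_mul _
  have hWY : IndepFun (fun ω t ↦ W t ω) (fun ω ↦ ∑ i, t (Sum.inr i) * ε i ω) P := by
    have hφ : Measurable fun e : Fin n → ℝ ↦ ∑ i, t (Sum.inr i) * e i := by fun_prop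
    exact hind.comp measurable_id hφ
  have key := hlim.integral_cexp_add hW hY hWY
  rw [hG] at key
  rw [charFun_apply, integral_map (by fun_prop) (by fun_prop), integral_map hm (by fun_prop)]
  simp only [PiLp.inner_apply, Fintype.sum_sum_type, Sum.elim_inl, Sum.elim_inr,
    RCLike.inner_apply, conj_trivial] at hεc ⊢
  rw [key, hεc, Fintype.prod_sum_type]
  congr 1
  simp only [charFun_gaussianReal]
  rw [← Complex.exp_sum]
  congr 1
  push_cast
  rw [← Finset.sum_neg_distrib, Finset.sum_div]
  refine Finset.sum_congr rfl fun i _ ↦ ?_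
  simp; ring

end StepLimits

end VolatilityModel

/-! ### The law of the observations as a linear image of a standard Gaussian vector. -/

namespace VolatilityModel

section ObsLaw

theorem obsTime_eq {n : ℕ} (i : Fin n) : obsTime i = ((i + 1 : ℕ) : ℝ≥0) / n := by
  simp [obsTime]

/-- The data vector `a_i ∑_{j ≤ i} s_j z_j + τ e_i` as a function of `x = (z, e)`. -/
def obsMap {n : ℕ} (a s : Fin n → ℝ) (τ : ℝ) (x : Fin n ⊕ Fin n → ℝ) (i : Fin n) : ℝ :=
  a i * ∑ j ∈ Finset.Iic i, s j * x (Sum.inl j) + τ * x (Sum.inr i)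

theorem measurable_obsMap {n : ℕ} (a s : Fin n → ℝ) (τ : ℝ) : Measurable (obsMap a s τ) := by
  unfold obsMap; fun_prop

theorem sum_Iic_sub_eq {n : ℕ} (X : ℕ → ℝ) (i : Fin n) :
    ∑ j ∈ Finset.Iic i, (X (j + 1) - X j) = X (i + 1) - X 0 := by
  rw [← Finset.sum_range_sub X (i + 1)]
  refine Finset.sum_bij (fun j _ ↦ (j : ℕ)) ?_ ?_ ?_ ?_
  · intro j hj
    have h := Finset.mem_Iic.1 hj
    have h' : (j : ℕ) ≤ i := h
    simp; omega
  · exact fun j _ k _ h ↦ Fin.ext h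
  · intro k hk
    have hk' := Finset.mem_range.1 hk
    exact ⟨⟨k, by omega⟩, by simp [Fin.le_def]; omega, rfl⟩
  · simp

variable {Ω : Type*} [MeasurableSpace Ω] {P : Measure Ω} {W : ℝ≥0 → Ω → ℝ}

theorem memLp_indicator_of_continuousOn {g : ℝ → ℝ} (hg : ContinuousOn g (Icc 0 1)) {t : ℝ}
    (ht : t ≤ 1) : MemLp ((Ioc (0 : ℝ) t).indicator g) 2 volume := by
  rw [memLp_indicator_iff_restrict measurableSet_Ioc]
  have hsub : Ioc (0 : ℝ) t ⊆ Icc 0 1 := fun x hx ↦ ⟨hx.1.le, hx.2.trans ht⟩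
  obtain ⟨C, hC⟩ := isCompact_Icc.exists_bound_of_continuousOn hg
  refine MemLp.of_bound ((hg.mono hsub).aestronglyMeasurable measurableSet_Ioc) C ?_
  exact (ae_restrict_iff' measurableSet_Ioc).2 (ae_of_all _ fun x hx ↦ hC x (hsub hx))

theorem IsWienerIntegral.isStepLimit {g : ℝ → ℝ} (hg : ContinuousOn g (Icc 0 1)) {t : ℝ≥0}
    (ht : t ≤ 1) {X : Ω → ℝ} (hX : IsWienerIntegral W P g t X) :
    IsStepLimit W P ((Ioc (0 : ℝ) t).indicator g) X :=
  ⟨memLp_indicator_of_continuousOn hg (by exact_mod_cast ht), hX⟩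

theorem isWienerIntegral_one [IsProbabilityMeasure P] (hW : IsPreBrownianReal W P) (t : ℝ≥0) :
    IsWienerIntegral W P (fun _ ↦ 1) t (fun ω ↦ W t ω - W 0 ω) := by
  have hm : ∀ t, MemLp (W t) 2 P := fun t ↦
    (hW.isGaussianProcess.hasGaussianLaw_eval t).memLp_two
  refine ⟨(hm t).sub (hm 0), fun _ ↦ ⟨1, fun _ ↦ 1, fun _ ↦ 0, fun _ ↦ t, fun _ ↦ by simp⟩,
    ?_, ?_⟩ <;>
  simp [StepFun.eval, StepFun.integral]

/-- The cells are disjoint, so the cross terms in the square vanish. -/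
theorem integral_sq_sum_indicator {g : ℝ → ℝ} (hg : ContinuousOn g (Icc 0 1)) {n : ℕ}
    (hn : 0 < n) (c : Fin n → ℝ) :
    ∫ x, (∑ j : Fin n, c j * (Ioc ((j : ℝ) / n) ((j + 1 : ℝ) / n)).indicator g x) ^ 2 =
      ∑ j : Fin n, c j ^ 2 * ∫ x in Ioc ((j : ℝ) / n) ((j + 1 : ℝ) / n), g x ^ 2 := by
  have hn' : (0 : ℝ) < n := by exact_mod_cast hn
  have hdis : ∀ (x : ℝ) (i j : Fin n), x ∈ Ioc ((i : ℝ) / n) ((i + 1 : ℝ) / n) →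
      x ∈ Ioc ((j : ℝ) / n) ((j + 1 : ℝ) / n) → i = j := by
    intro x i j hi hj
    simp only [mem_Ioc, div_lt_iff₀ hn', le_div_iff₀ hn'] at hi hj
    have h1 : (i : ℝ) < j + 1 := hi.1.trans_le hj.2
    have h2 : (j : ℝ) < i + 1 := hj.1.trans_le hi.2
    have h1' : (i : ℕ) < j + 1 := by exact_mod_cast h1
    have h2' : (j : ℕ) < i + 1 := by exact_mod_cast h2
    exact Fin.ext (by omega)
  have hsq : ∀ x, (∑ j : Fin n, c j * (Ioc ((j : ℝ) / n) ((j + 1 : ℝ) / n)).indicator g x) ^ 2 =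
      ∑ j : Fin n, c j ^ 2 *
        (Ioc ((j : ℝ) / n) ((j + 1 : ℝ) / n)).indicator (fun x ↦ g x ^ 2) x := by
    intro x
    by_cases hx : ∃ i : Fin n, x ∈ Ioc ((i : ℝ) / n) ((i + 1 : ℝ) / n)
    · obtain ⟨i, hi⟩ := hx
      have hne : ∀ j, j ≠ i → x ∉ Ioc ((j : ℝ) / n) ((j + 1 : ℝ) / n) :=
        fun j hj h ↦ hj (hdis x j i h hi)
      rw [Finset.sum_eq_single i, Finset.sum_eq_single i]
      · simp only [indicator_of_mem hi]; ring
      · intro j _ hj; rw [indicator_of_notMem (hne j hj), mul_zero]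
      · simp
      · intro j _ hj; rw [indicator_of_notMem (hne j hj), mul_zero]
      · simp
    · push Not at hx
      rw [Finset.sum_eq_zero, Finset.sum_eq_zero]
      · simp
      · intro j _; rw [indicator_of_notMem (hx j), mul_zero]
      · intro j _; rw [indicator_of_notMem (hx j), mul_zero]
  have hint : ∀ j : Fin n, Integrable
      ((Ioc ((j : ℝ) / n) ((j + 1 : ℝ) / n)).indicator (fun x ↦ g x ^ 2)) := by
    intro j
    rw [integrable_indicator_iff measurableSet_Ioc]
    refine ContinuousOn.integrableOn_Icc ?_ |>.mono_set Ioc_subset_Icc_self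
    refine (hg.pow 2).mono (Icc_subset_Icc (by positivity) ?_)
    rw [div_le_one hn']
    have : (j : ℕ) + 1 ≤ n := j.2
    exact_mod_cast this
  simp only [hsq]
  rw [integral_finsetSum _ fun j _ ↦ (hint j).const_mul _]
  refine Finset.sum_congr rfl fun j _ ↦ ?_
  rw [integral_const_mul, integral_indicator measurableSet_Ioc]

/-- The law of the vector with components `a_i X_{i+1} + τ ε_i`, where `X_k` is the Wiener integral
of `g` up to time `k/n`. -/
theorem lintegral_obs_eq (hW : IsPreBrownianReal W P) {n : ℕ} (hn : 0 < n)
    {g : ℝ → ℝ} (hg : ContinuousOn g (Icc 0 1)) {X : ℕ → Ω → ℝ} (hX0 : ∀ ω, X 0 ω = 0)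
    (hX : ∀ k ≤ n, IsWienerIntegral W P g ((k : ℝ≥0) / n) (X k)) {s : Fin n → ℝ}
    (hs : ∀ j, 0 < s j)
    (hsg : ∀ j : Fin n, s j ^ 2 = ∫ x in Ioc ((j : ℝ) / n) ((j + 1 : ℝ) / n), g x ^ 2)
    {ε : Fin n → Ω → ℝ}
    (hε : ∀ i, HasLaw (ε i) (gaussianReal 0 1) P) (hi : iIndepFun ε P)
    (hind : IndepFun (fun ω t ↦ W t ω) (fun ω i ↦ ε i ω) P) (a : Fin n → ℝ) (τ : ℝ)
    {F : (Fin n → ℝ) → ℝ≥0∞} (hF : Measurable F) :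
    ∫⁻ ω, F (fun i ↦ a i * X (i + 1) ω + τ * ε i ω) ∂P =
      ∫⁻ x, F (obsMap a s τ x) ∂(stdGaussianPi (Fin n ⊕ Fin n)) := by
  have hn' : (0 : ℝ) < n := by exact_mod_cast hn
  -- Normalised increments over the cells; by `hsg` their integrands are orthonormal. The factor
  -- `-1` matches the closure properties of `IsStepLimit`.
  set Z : Fin n → Ω → ℝ := fun j ω ↦ (s j)⁻¹ * (X (j + 1) ω + -1 * X j ω) with hZ
  have hlim : ∀ k ≤ n, IsStepLimit W P ((Ioc (0 : ℝ) ((k : ℝ≥0) / n : ℝ≥0)).indicator g) (X k) := by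
    intro k hk
    refine (hX k hk).isStepLimit hg ?_
    rw [div_le_one (by exact_mod_cast hn)]
    exact_mod_cast hk
  have hZlim : ∀ j : Fin n, IsStepLimit W P
      (fun x ↦ (s j)⁻¹ * ((Ioc (0 : ℝ) ((j + 1 : ℕ) / n : ℝ≥0)).indicator g x +
        -1 * (Ioc (0 : ℝ) ((j : ℕ) / n : ℝ≥0)).indicator g x)) (Z j) := fun j ↦
    ((hlim (j + 1) j.2).add hW ((hlim j j.2.le).const_mul (-1))).const_mul _
  have hGe : ∀ (j : Fin n) (x : ℝ),
      (Ioc (0 : ℝ) (((j + 1 : ℕ) : ℝ≥0) / n : ℝ≥0)).indicator g x +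
        -1 * (Ioc (0 : ℝ) (((j : ℕ) : ℝ≥0) / n : ℝ≥0)).indicator g x =
      (Ioc ((j : ℝ) / n) ((j + 1 : ℝ) / n)).indicator g x := by
    intro j x
    have h1 : (0 : ℝ) ≤ (j : ℝ) / n := by positivity
    have h2 : (j : ℝ) / n ≤ (j + 1 : ℝ) / n := by gcongr; linarith
    simp only [indicator_apply, mem_Ioc, NNReal.coe_div, NNReal.coe_natCast, Nat.cast_add,
      Nat.cast_one]
    by_cases hx0 : 0 < x <;> by_cases hx1 : x ≤ (j : ℝ) / n <;>
      by_cases hx2 : x ≤ (j + 1 : ℝ) / n <;> simp [hx0, hx1, hx2] <;> intros <;> linarith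
  have hmap := map_sumElim_eq_stdGaussianPi hW hZlim (fun c ↦ by
    simp only [hGe, ← mul_assoc]
    rw [integral_sq_sum_indicator hg hn]
    refine Finset.sum_congr rfl fun j _ ↦ ?_
    rw [← hsg]
    have := (hs j).ne'
    field_simp) hε hi hind
  have hm : AEMeasurable (fun ω ↦ (Sum.elim (fun j ↦ Z j ω) (fun i ↦ ε i ω) :
      Fin n ⊕ Fin n → ℝ)) P := by
    refine aemeasurable_pi_iff.2 ?_
    rintro (j | i)
    exacts [(hZlim j).2.1.aemeasurable, (hε i).aemeasurable]
  have hFm : Measurable fun x ↦ F (obsMap a s τ x) := hF.comp (measurable_obsMap a s τ)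
  rw [← hmap, lintegral_map' hFm.aemeasurable hm]
  refine lintegral_congr fun ω ↦ ?_
  congr 1
  ext i
  simp only [obsMap, Sum.elim_inl, Sum.elim_inr, hZ]
  have e : ∀ j : Fin n, s j * ((s j)⁻¹ * (X (j + 1) ω + -1 * X j ω)) = X (j + 1) ω - X j ω :=
    fun j ↦ by have := (hs j).ne'; field_simp; ring
  simp only [e]
  rw [sum_Iic_sub_eq (fun k ↦ X k ω), hX0, sub_zero]

theorem lintegral_obsIntegral (hW : IsPreBrownianReal W P) {n : ℕ} (hn : 0 < n)
    {f : ℝ → ℝ} (hf : ContinuousOn f (Icc 0 1)) (hf0 : ∀ x ∈ Icc (0 : ℝ) 1, 0 ≤ f x)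
    {s : Fin n → ℝ} (hs : ∀ j, 0 < s j)
    (hsf : ∀ j : Fin n, s j ^ 2 = ∫ x in Ioc ((j : ℝ) / n) ((j + 1 : ℝ) / n), f x)
    {ε : Fin n → Ω → ℝ}
    (hε : ∀ i, HasLaw (ε i) (gaussianReal 0 1) P) (hi : iIndepFun ε P)
    (hind : IndepFun (fun ω t ↦ W t ω) (fun ω i ↦ ε i ω) P) (τ : ℝ)
    {F : (Fin n → ℝ) → ℝ≥0∞} (hF : Measurable F) :
    ∫⁻ ω, F (obsIntegral P W τ ε f ω) ∂P =
      ∫⁻ x, F (obsMap (fun _ ↦ 1) s τ x) ∂(stdGaussianPi (Fin n ⊕ Fin n)) := by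
  have hn' : (0 : ℝ) < n := by exact_mod_cast hn
  have hg : ContinuousOn (fun x ↦ √(f x)) (Icc 0 1) := hf.sqrt
  -- The value at `k = 0` is set to zero by hand: the chosen version of the integral up to time `0`
  -- vanishes only almost surely, while the telescoping sum needs it everywhere.
  set X : ℕ → Ω → ℝ := fun k ↦ Nat.casesOn k 0 fun k ↦
    wienerIntegral W P (fun x ↦ √(f x)) (((k + 1 : ℕ) : ℝ≥0) / n) with hXdef
  have hX : ∀ k ≤ n, IsWienerIntegral W P (fun x ↦ √(f x)) ((k : ℝ≥0) / n) (X k) := by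
    rintro (_ | k) hk
    · refine ⟨MemLp.zero, fun _ ↦ StepFun.zero, ?_, ?_⟩ <;>
        simp [StepFun.zero, StepFun.eval, StepFun.integral, X]
    · refine isWienerIntegral_wienerIntegral hW (hg.mono (Icc_subset_Icc_right ?_))
      rw [NNReal.coe_div, NNReal.coe_natCast, NNReal.coe_natCast, div_le_one hn']
      exact_mod_cast hk
  have key := lintegral_obs_eq hW hn hg (X := X) (fun ω ↦ rfl) hX hs (fun j ↦ by
    rw [hsf]
    refine setIntegral_congr_fun measurableSet_Ioc fun x hx ↦ ?_
    refine (Real.sq_sqrt (hf0 x ⟨le_trans (by positivity) hx.1.le, hx.2.trans ?_⟩)).symm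
    rw [div_le_one hn']
    have : (j : ℕ) + 1 ≤ n := j.2
    exact_mod_cast this) hε hi hind (fun _ ↦ 1) τ hF
  rw [← key]
  refine lintegral_congr fun ω ↦ ?_
  congr 1
  ext i
  simp [obsIntegral, obsTime_eq, X]

/-- Here `g = 1` and `f` enters only through the outer factors. As `W 0 = 0` holds only almost
surely, `X` is taken to be `W - W 0`. -/
theorem lintegral_obsProduct (hW : IsPreBrownianReal W P) {n : ℕ} (hn : 0 < n) (f : ℝ → ℝ)
    {ε : Fin n → Ω → ℝ}
    (hε : ∀ i, HasLaw (ε i) (gaussianReal 0 1) P) (hi : iIndepFun ε P)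
    (hind : IndepFun (fun ω t ↦ W t ω) (fun ω i ↦ ε i ω) P) (τ : ℝ)
    {F : (Fin n → ℝ) → ℝ≥0∞} (hF : Measurable F) :
    ∫⁻ ω, F (obsProduct W τ ε f ω) ∂P =
      ∫⁻ x, F (obsMap (fun i ↦ √(f ((i + 1 : ℝ) / n))) (fun _ ↦ √(1 / n)) τ x)
        ∂(stdGaussianPi (Fin n ⊕ Fin n)) := by
  have hP : IsProbabilityMeasure P := hW.isGaussianProcess.isProbabilityMeasure
  have hn' : (0 : ℝ) < n := by exact_mod_cast hn
  have key := lintegral_obs_eq hW hn (g := fun _ ↦ 1) continuousOn_const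
    (X := fun k ω ↦ W ((k : ℝ≥0) / n) ω - W 0 ω) (fun ω ↦ by simp)
    (fun k _ ↦ isWienerIntegral_one hW _) (s := fun _ ↦ √(1 / n))
    (fun j ↦ Real.sqrt_pos.2 (by positivity)) (fun j ↦ by
      rw [Real.sq_sqrt (by positivity)]
      have h : (j : ℝ) / n ≤ (j + 1 : ℝ) / n := by gcongr; linarith
      simp [h]
      ring) hε hi hind (fun i ↦ √(f ((i + 1 : ℝ) / n))) τ hF
  rw [← key]
  refine lintegral_congr_ae ?_
  filter_upwards [hW.eval_zero_ae_eq_zero] with ω hω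
  congr 1
  ext i
  simp [obsProduct, obsTime_eq, hω]

end ObsLaw

end VolatilityModel

namespace VolatilityModel

/-! ### A unipotent transformation which relates two observation schemes -/

section Transform

/-- The linear ramp `min(k, K) / K`. -/
noncomputable def ramp (K k : ℕ) : ℝ := (min k K : ℕ) / K

theorem ramp_zero (K : ℕ) : ramp K 0 = 0 := by simp [ramp]

theorem ramp_nonneg (K k : ℕ) : 0 ≤ ramp K k := by unfold ramp; positivity

theorem ramp_le_one (K k : ℕ) : ramp K k ≤ 1 := by
  unfold ramp
  exact div_le_one_of_le₀ (by exact_mod_cast min_le_right k K) (by positivity)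

theorem ramp_of_le {K k : ℕ} (hK : 0 < K) (h : K ≤ k) : ramp K k = 1 := by
  have : (K : ℝ) ≠ 0 := by exact_mod_cast hK.ne'
  simp [ramp, min_eq_right h, this]

/-- The slope of the ramp is `1/K` on exactly `K` lags. Truncated subtraction makes the ramp vanish
above the diagonal and takes care of `p = 0`. -/
theorem ramp_sub_ramp {K : ℕ} (hK : 0 < K) (p j : ℕ) :
    ramp K (p - j) - ramp K (p - 1 - j) = if j + 1 ≤ p ∧ p < j + 1 + K then (K : ℝ)⁻¹ else 0 := by
  have hK' : (K : ℝ) ≠ 0 := by exact_mod_cast hK.ne'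
  split_ifs with h
  · have h1 : min (p - j) K = p - j := by omega
    have h2 : min (p - 1 - j) K = p - j - 1 := by omega
    rw [ramp, ramp, h1, h2, Nat.cast_sub (by omega : 1 ≤ p - j)]
    field_simp; simp
  · have : min (p - j) K = min (p - 1 - j) K := by omega
    rw [ramp, ramp, this, sub_self]

theorem card_band_left {n : ℕ} (K δ : ℕ) (p : Fin n) :
    (Finset.univ.filter fun j : Fin n ↦ (j : ℕ) + δ ≤ p ∧ (p : ℕ) < j + δ + K).card ≤ K := by
  rw [← Finset.card_map Fin.valEmbedding]
  refine (Finset.card_le_card (t := Finset.Ico ((p : ℕ) + 1 - δ - K) ((p : ℕ) + 1 - δ)) ?_).trans ?_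
  · intro x hx
    simp only [Finset.mem_map, Finset.mem_filter, Finset.mem_univ, true_and,
      Fin.valEmbedding_apply] at hx
    obtain ⟨j, hj, rfl⟩ := hx
    simp only [Finset.mem_Ico]; omega
  · rw [Nat.card_Ico]; omega

theorem card_band_right {n : ℕ} (K δ : ℕ) (j : Fin n) :
    (Finset.univ.filter fun p : Fin n ↦ (j : ℕ) + δ ≤ p ∧ (p : ℕ) < j + δ + K).card ≤ K := by
  rw [← Finset.card_map Fin.valEmbedding]
  refine (Finset.card_le_card (t := Finset.Ico ((j : ℕ) + δ) ((j : ℕ) + δ + K)) ?_).trans ?_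
  · intro x hx
    simp only [Finset.mem_map, Finset.mem_filter, Finset.mem_univ, true_and,
      Fin.valEmbedding_apply] at hx
    obtain ⟨j, hj, rfl⟩ := hx
    simp only [Finset.mem_Ico]; omega
  · rw [Nat.card_Ico]; omega

/-- A band of width `K` meets each row and each column in at most `K` places. -/
theorem sum_band_le {n : ℕ} (K δ : ℕ) {u v : Fin n → ℝ} (hu : ∀ i, 0 ≤ u i) (hv : ∀ i, 0 ≤ v i) :
    ∑ p : Fin n, ∑ j : Fin n, (if (j : ℕ) + δ ≤ p ∧ (p : ℕ) < j + δ + K then u p + v j else 0) ≤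
      K * (∑ i, u i + ∑ i, v i) := by
  have e : ∀ p j : Fin n, (if (j : ℕ) + δ ≤ p ∧ (p : ℕ) < j + δ + K then u p + v j else 0) =
      (if (j : ℕ) + δ ≤ p ∧ (p : ℕ) < j + δ + K then u p else 0) +
      (if (j : ℕ) + δ ≤ p ∧ (p : ℕ) < j + δ + K then v j else 0) := by
    intro p j; split_ifs <;> simp
  simp only [e, Finset.sum_add_distrib, mul_add, Finset.mul_sum]
  refine add_le_add (Finset.sum_le_sum fun p _ ↦ ?_) ?_
  · rw [← Finset.sum_filter, Finset.sum_const, nsmul_eq_mul]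
    exact mul_le_mul_of_nonneg_right (by exact_mod_cast card_band_left K δ p) (hu p)
  · rw [Finset.sum_comm]
    refine Finset.sum_le_sum fun j _ ↦ ?_
    rw [← Finset.sum_filter, Finset.sum_const, nsmul_eq_mul]
    exact mul_le_mul_of_nonneg_right (by exact_mod_cast card_band_right K δ j) (hv j)

variable {n : ℕ}

/-- The strictly lower triangular part of the transformation of the Brownian increments. -/
noncomputable def signalShift (K : ℕ) (s : Fin n → ℝ) (Q : ℕ → Fin n → ℝ) :
    Matrix (Fin n) (Fin n) ℝ :=
  fun p j ↦ (s p)⁻¹ * (Q p j * ramp K (p - j) - Q (p - 1) j * ramp K (p - 1 - j))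

/-- The shift of the noise. -/
noncomputable def noiseShift (K : ℕ) (a : Fin n → ℝ) (τ : ℝ) (Q : ℕ → Fin n → ℝ) :
    Matrix (Fin n) (Fin n) ℝ :=
  fun i j ↦ if j ≤ i then τ⁻¹ * (a i * Q i j * (1 - ramp K (i - j))) else 0

/-- The transformation of `(z, e)` which turns one observation scheme into another one. -/
noncomputable def schemeShift (K : ℕ) (a s : Fin n → ℝ) (τ : ℝ) (Q : ℕ → Fin n → ℝ) :
    Matrix (Fin n ⊕ Fin n) (Fin n ⊕ Fin n) ℝ :=
  Matrix.fromBlocks (1 + signalShift K s Q) 0 (noiseShift K a τ Q) 1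

theorem signalShift_eq_zero {K : ℕ} {s : Fin n → ℝ} {Q : ℕ → Fin n → ℝ} {p j : Fin n}
    (h : p ≤ j) : signalShift K s Q p j = 0 := by
  have h' : (p : ℕ) ≤ j := h
  rw [signalShift, show (p : ℕ) - j = 0 by omega, show (p : ℕ) - 1 - j = 0 by omega, ramp_zero]
  simp

theorem det_schemeShift (K : ℕ) (a s : Fin n → ℝ) (τ : ℝ) (Q : ℕ → Fin n → ℝ) :
    (schemeShift K a s τ Q).det = 1 := by
  rw [schemeShift, Matrix.det_fromBlocks_zero₁₂, Matrix.det_one, mul_one,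
    Matrix.det_of_isLowerTriangular]
  · simp [signalShift_eq_zero]
  · intro i j hij
    have h : i < j := hij
    simp [Matrix.one_apply_ne h.ne, signalShift_eq_zero h.le]

/-- The shifts sit off the diagonal, so no cross terms with the identity appear and the excess over
the dimension is purely quadratic. -/
theorem sum_sq_schemeShift (K : ℕ) (a s : Fin n → ℝ) (τ : ℝ) (Q : ℕ → Fin n → ℝ) :
    ∑ i, ∑ j, schemeShift K a s τ Q i j ^ 2 = Fintype.card (Fin n ⊕ Fin n) +
      (∑ i, ∑ j, signalShift K s Q i j ^ 2 + ∑ i, ∑ j, noiseShift K a τ Q i j ^ 2) := by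
  have e1 : ∀ i j, (1 + signalShift K s Q) i j ^ 2 =
      (1 : Matrix (Fin n) (Fin n) ℝ) i j + signalShift K s Q i j ^ 2 := by
    intro i j
    by_cases h : i = j
    · subst h; simp [signalShift_eq_zero le_rfl]
    · simp [Matrix.one_apply_ne h]
  have e2 : ∀ i j, (1 : Matrix (Fin n) (Fin n) ℝ) i j ^ 2 = (1 : Matrix (Fin n) (Fin n) ℝ) i j := by
    intro i j
    by_cases h : i = j <;> simp [Matrix.one_apply, h]
  have e3 : ∀ i, ∑ j, (1 : Matrix (Fin n) (Fin n) ℝ) i j = 1 := by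
    intro i; simp [Matrix.one_apply]
  simp only [Fintype.sum_sum_type, schemeShift, Matrix.fromBlocks_apply₁₁,
    Matrix.fromBlocks_apply₁₂, Matrix.fromBlocks_apply₂₁, Matrix.fromBlocks_apply₂₂, e1, e2,
    Finset.sum_add_distrib, e3]
  simp
  ring

/-- Summed up to `i`, the shifted increments telescope to `Q i j · ramp (i - j)`; the noise supplies
the share `1 - ramp (i - j)`. Together they give the full change `a_i Q i j` of the coefficient of
`z_j`. -/
theorem obsMap_schemeShift (K : ℕ) {a s a' s' : Fin n → ℝ} {τ : ℝ} {Q : ℕ → Fin n → ℝ}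
    (hτ : τ ≠ 0) (hs : ∀ j, s j ≠ 0)
    (hQ : ∀ i j : Fin n, a' i * s' j - a i * s j = a i * Q i j) (x : Fin n ⊕ Fin n → ℝ) :
    obsMap a s τ ((schemeShift K a s τ Q).mulVec x) = obsMap a' s' τ x := by
  ext i
  have h1 : ∀ p, (schemeShift K a s τ Q).mulVec x (Sum.inl p) =
      x (Sum.inl p) + ∑ j, signalShift K s Q p j * x (Sum.inl j) := by
    intro p
    simp [schemeShift, Matrix.mulVec, dotProduct, Fintype.sum_sum_type, add_mul,
      Finset.sum_add_distrib, Matrix.one_apply]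
  have h2 : (schemeShift K a s τ Q).mulVec x (Sum.inr i) =
      ∑ j, noiseShift K a τ Q i j * x (Sum.inl j) + x (Sum.inr i) := by
    simp [schemeShift, Matrix.mulVec, dotProduct, Fintype.sum_sum_type, Matrix.one_apply]
  have h3 : ∀ j : Fin n, ∑ p ∈ Finset.Iic i, s p * signalShift K s Q p j =
      Q i j * ramp K (i - j) := by
    intro j
    -- The index is shifted by one so that the last term of the sum over `p ≤ i` carries `Q i j`;
    -- the boundary term at `k = 0` vanishes because the ramp does.
    have h := sum_Iic_sub_eq (fun k ↦ Q (k - 1) j * ramp K (k - 1 - j)) i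
    simp only [Nat.add_sub_cancel] at h
    rw [show 0 - 1 - (j : ℕ) = 0 by omega, ramp_zero, mul_zero, sub_zero] at h
    rw [← h]
    refine Finset.sum_congr rfl fun p _ ↦ ?_
    rw [signalShift, mul_inv_cancel_left₀ (hs p)]
  have h4 : ∀ j : Fin n, a i * (Q i j * ramp K (i - j)) + τ * noiseShift K a τ Q i j =
      if j ≤ i then a i * Q i j else 0 := by
    intro j
    unfold noiseShift
    split_ifs with h
    · field_simp; ring
    · have : ¬ (j : ℕ) ≤ i := h
      rw [show (i : ℕ) - j = 0 by omega, ramp_zero]; simp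
  simp only [obsMap, h1, h2, mul_add, Finset.sum_add_distrib, Finset.mul_sum]
  rw [Finset.sum_comm]
  have h5 : ∀ j : Fin n, ∑ p ∈ Finset.Iic i, a i * (s p * (signalShift K s Q p j * x (Sum.inl j))) =
      a i * (Q i j * ramp K (i - j)) * x (Sum.inl j) := by
    intro j
    rw [← h3, Finset.mul_sum, Finset.sum_mul]
    exact Finset.sum_congr rfl fun p _ ↦ by ring
  simp only [h5]
  have h6 : ∑ j, a i * (Q i j * ramp K (i - j)) * x (Sum.inl j) +
      ∑ j, τ * (noiseShift K a τ Q i j * x (Sum.inl j)) =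
      ∑ j ∈ Finset.Iic i, a i * Q i j * x (Sum.inl j) := by
    rw [← Finset.sum_add_distrib, ← Finset.filter_univ_mem (Finset.Iic i), Finset.sum_filter]
    refine Finset.sum_congr rfl fun j _ ↦ ?_
    have h4' : a i * (Q i j * ramp K (i - j)) * x (Sum.inl j) +
        τ * (noiseShift K a τ Q i j * x (Sum.inl j)) =
        (if j ≤ i then a i * Q i j else 0) * x (Sum.inl j) := by rw [← h4 j]; ring
    rw [h4']
    simp only [Finset.mem_Iic]
    split_ifs <;> simp
  have h7 : ∑ j ∈ Finset.Iic i, a i * (s j * x (Sum.inl j)) +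
      ∑ j ∈ Finset.Iic i, a i * Q i j * x (Sum.inl j) =
      ∑ j ∈ Finset.Iic i, a' i * (s' j * x (Sum.inl j)) := by
    rw [← Finset.sum_add_distrib]
    refine Finset.sum_congr rfl fun j _ ↦ ?_
    rw [← hQ i j]; ring
  rw [← h7, ← h6]
  ring

/-- Discrete product rule: either the ramp moves, by `1/K` on a band of width `K`, which contributes
`K · K⁻²`, or `Q` moves in its row index. The majorant `α p + β j` serves perturbations that depend
on the row or on the column only. -/
theorem sum_sq_signalShift_le {K : ℕ} (hK : 0 < K) {s : Fin n → ℝ} {Q : ℕ → Fin n → ℝ} {v : ℝ}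
    (hv : 0 < v) (hs : ∀ p, v ≤ s p ^ 2) {α β : Fin n → ℝ} (hα : ∀ i, 0 ≤ α i)
    (hβ : ∀ i, 0 ≤ β i) (hQ : ∀ p j : Fin n, Q p j ^ 2 ≤ α p + β j) :
    ∑ i, ∑ j, signalShift K s Q i j ^ 2 ≤ 2 / v * ((∑ i, α i + ∑ i, β i) / K +
      ∑ p : Fin n, ∑ j, (Q p j - Q (p - 1) j) ^ 2) := by
  have hK' : (0 : ℝ) < K := by exact_mod_cast hK
  have h : ∀ p j : Fin n, signalShift K s Q p j ^ 2 ≤ 2 / v *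
      (((K : ℝ)⁻¹) ^ 2 * (if (j : ℕ) + 1 ≤ p ∧ (p : ℕ) < j + 1 + K then α p + β j else 0) +
        (Q p j - Q (p - 1) j) ^ 2) := by
    intro p j
    have hr := ramp_sub_ramp hK p j
    set w := ramp K (p - j)
    have hw0 := ramp_nonneg K (p - 1 - j)
    have hw1 := ramp_le_one K (p - 1 - j)
    set w' := ramp K (p - 1 - j)
    have e : Q p j * w - Q (p - 1) j * w' = Q p j * (w - w') + (Q p j - Q (p - 1) j) * w' := by ring
    have hsp : (s p ^ 2)⁻¹ ≤ v⁻¹ := inv_anti₀ hv (hs p)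
    rw [signalShift, mul_pow, inv_pow, e]
    have h1 : (Q p j * (w - w') + (Q p j - Q (p - 1) j) * w') ^ 2 ≤
        2 * ((Q p j * (w - w')) ^ 2 + ((Q p j - Q (p - 1) j) * w') ^ 2) := by
      nlinarith [sq_nonneg (Q p j * (w - w') - (Q p j - Q (p - 1) j) * w')]
    have h2 : ((Q p j - Q (p - 1) j) * w') ^ 2 ≤ (Q p j - Q (p - 1) j) ^ 2 := by
      rw [mul_pow]
      exact mul_le_of_le_one_right (sq_nonneg _) (pow_le_one₀ hw0 hw1)
    have h3 : (Q p j * (w - w')) ^ 2 ≤ ((K : ℝ)⁻¹) ^ 2 *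
        (if (j : ℕ) + 1 ≤ p ∧ (p : ℕ) < j + 1 + K then α p + β j else 0) := by
      rw [hr]
      split_ifs
      · rw [mul_pow, mul_comm]
        exact mul_le_mul_of_nonneg_left (hQ p j) (by positivity)
      · simp
    calc _ ≤ v⁻¹ * (2 * ((Q p j * (w - w')) ^ 2 + ((Q p j - Q (p - 1) j) * w') ^ 2)) :=
          mul_le_mul hsp h1 (sq_nonneg _) (by positivity)
      _ ≤ v⁻¹ * (2 * (((K : ℝ)⁻¹) ^ 2 *
          (if (j : ℕ) + 1 ≤ p ∧ (p : ℕ) < j + 1 + K then α p + β j else 0) +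
          (Q p j - Q (p - 1) j) ^ 2)) := by gcongr
      _ = _ := by ring
  refine (Finset.sum_le_sum fun p _ ↦ Finset.sum_le_sum fun j _ ↦ h p j).trans ?_
  simp only [← Finset.mul_sum, Finset.sum_add_distrib]
  refine mul_le_mul_of_nonneg_left (add_le_add ?_ le_rfl) (by positivity)
  refine (mul_le_mul_of_nonneg_left (sum_band_le K 1 hα hβ) (by positivity)).trans (le_of_eq ?_)
  field_simp

/-- From lag `K` on the ramp equals one and the noise is untouched, so only a band of width `K`,
diagonal included, contributes. -/
theorem sum_sq_noiseShift_le {K : ℕ} (hK : 0 < K) {a : Fin n → ℝ} {τ : ℝ}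
    {Q : ℕ → Fin n → ℝ} {A : ℝ} (ha : ∀ i, a i ^ 2 ≤ A) {α β : Fin n → ℝ}
    (hα : ∀ i, 0 ≤ α i) (hβ : ∀ i, 0 ≤ β i) (hQ : ∀ p j : Fin n, Q p j ^ 2 ≤ α p + β j) :
    ∑ i, ∑ j, noiseShift K a τ Q i j ^ 2 ≤ A / τ ^ 2 * (K * (∑ i, α i + ∑ i, β i)) := by
  rcases Nat.eq_zero_or_pos n with rfl | hn
  · simp
  have hA : 0 ≤ A := (sq_nonneg _).trans (ha ⟨0, hn⟩)
  have h : ∀ p j : Fin n, noiseShift K a τ Q p j ^ 2 ≤ A / τ ^ 2 *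
      (if (j : ℕ) + 0 ≤ p ∧ (p : ℕ) < j + 0 + K then α p + β j else 0) := by
    intro p j
    unfold noiseShift
    by_cases hjp : j ≤ p
    · have hjp' : (j : ℕ) ≤ p := hjp
      rw [if_pos hjp]
      by_cases hpK : (p : ℕ) < j + K
      · rw [if_pos ⟨by omega, by omega⟩]
        have hw : (1 - ramp K (p - j)) ^ 2 ≤ 1 :=
          pow_le_one₀ (by linarith [ramp_le_one K (p - j)]) (by linarith [ramp_nonneg K (p - j)])
        calc _ = (τ ^ 2)⁻¹ * (a p ^ 2 * Q p j ^ 2 * (1 - ramp K (p - j)) ^ 2) := by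
              rw [mul_pow, mul_pow, mul_pow, inv_pow]
          _ ≤ (τ ^ 2)⁻¹ * (A * (α p + β j) * 1) := by
              gcongr
              · exact mul_nonneg hA (add_nonneg (hα p) (hβ j))
              · exact ha p
              · exact hQ p j
          _ = _ := by ring
      · rw [if_neg (by omega), ramp_of_le hK (by omega)]; simp
    · have hjp' : ¬ (j : ℕ) ≤ p := hjp
      rw [if_neg hjp, if_neg (by omega)]; simp
  refine (Finset.sum_le_sum fun p _ ↦ Finset.sum_le_sum fun j _ ↦ h p j).trans ?_
  simp only [← Finset.mul_sum]
  exact mul_le_mul_of_nonneg_left (sum_band_le K 0 hα hβ) (by positivity)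

theorem two_point_obsMap {K : ℕ} (hK : 0 < K) {a s a' s' : Fin n → ℝ} {τ : ℝ}
    {Q : ℕ → Fin n → ℝ} (hτ : τ ≠ 0)
    (hQe : ∀ i j : Fin n, a' i * s' j - a i * s j = a i * Q i j) {v A : ℝ}
    (hv : 0 < v) (hs : ∀ p, v ≤ s p ^ 2) (ha : ∀ i, a i ^ 2 ≤ A) {α β : Fin n → ℝ}
    (hα : ∀ i, 0 ≤ α i) (hβ : ∀ i, 0 ≤ β i) (hQ : ∀ p j : Fin n, Q p j ^ 2 ≤ α p + β j)
    (hle : 2 / v * ((∑ i, α i + ∑ i, β i) / K + ∑ p : Fin n, ∑ j, (Q p j - Q (p - 1) j) ^ 2) +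
      A / τ ^ 2 * (K * (∑ i, α i + ∑ i, β i)) ≤ 1)
    {F G : (Fin n → ℝ) → ℝ≥0∞} (hF : Measurable F) (hG : Measurable G) {D : ℝ≥0∞}
    (hD : ∀ y, D ≤ F y + G y) :
    D * ENNReal.ofReal (1 / 4) ≤
      ∫⁻ x, F (obsMap a s τ x) ∂(stdGaussianPi (Fin n ⊕ Fin n)) +
        ∫⁻ x, G (obsMap a' s' τ x) ∂(stdGaussianPi (Fin n ⊕ Fin n)) := by
  have hs0 : ∀ j, s j ≠ 0 := fun j h ↦ by
    have := hs j
    rw [h] at this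
    norm_num at this
    linarith
  have hm := measurable_obsMap a s τ
  have h := two_point_stdGaussianPi (det_schemeShift K a s τ Q)
    (by
      rw [sum_sq_schemeShift]
      have h1 := sum_sq_signalShift_le hK hv hs hα hβ hQ
      have h2 := sum_sq_noiseShift_le (τ := τ) hK ha hα hβ hQ
      linarith) (hF.comp hm) (hG.comp hm) (fun x ↦ hD _)
  simpa only [Function.comp_apply, obsMap_schemeShift K hτ hs0 hQe] using h

end Transform

end VolatilityModel

namespace VolatilityModel

/-! ### Smooth bumps and the hypercube of perturbed functions -/

section Bumps

/-- A smooth function which is positive on `(0,1)` and vanishes elsewhere. -/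
noncomputable def unitBump (x : ℝ) : ℝ := expNegInvGlue x * expNegInvGlue (1 - x)

theorem contDiff_unitBump {k : ℕ∞} : ContDiff ℝ k unitBump :=
  expNegInvGlue.contDiff.mul (expNegInvGlue.contDiff.comp (contDiff_const.sub contDiff_id))

theorem expNegInvGlue_le_one (x : ℝ) : expNegInvGlue x ≤ 1 := by
  unfold expNegInvGlue
  split_ifs with h
  · exact zero_le_one
  · exact Real.exp_le_one_iff.2 (neg_nonpos.2 (inv_nonneg.2 (not_le.1 h).le))

theorem unitBump_nonneg (x : ℝ) : 0 ≤ unitBump x :=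
  mul_nonneg (expNegInvGlue.nonneg _) (expNegInvGlue.nonneg _)

theorem unitBump_le_one (x : ℝ) : unitBump x ≤ 1 :=
  mul_le_one₀ (expNegInvGlue_le_one _) (expNegInvGlue.nonneg _) (expNegInvGlue_le_one _)

theorem unitBump_eq_zero {x : ℝ} (hx : x ∉ Ioo (0 : ℝ) 1) : unitBump x = 0 := by
  rw [mem_Ioo, not_and_or, not_lt, not_lt] at hx
  unfold unitBump
  rcases hx with h | h
  · rw [expNegInvGlue.zero_of_nonpos h, zero_mul]
  · rw [expNegInvGlue.zero_of_nonpos (by linarith : 1 - x ≤ 0), mul_zero]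

theorem exists_le_unitBump :
    ∃ δ > 0, ∀ x ∈ Icc (1 / 4 : ℝ) (3 / 4), δ ≤ unitBump x := by
  obtain ⟨x, hx, hmin⟩ := isCompact_Icc.exists_isMinOn
    (nonempty_Icc.2 (by norm_num : (1 / 4 : ℝ) ≤ 3 / 4))
    (contDiff_unitBump (k := 0)).continuous.continuousOn
  refine ⟨unitBump x, ?_, fun y hy ↦ hmin hy⟩
  exact mul_pos (expNegInvGlue.pos_of_pos (by linarith [hx.1]))
    (expNegInvGlue.pos_of_pos (by linarith [hx.2]))

/-- Outside `[0,1]` the bump is locally zero; the endpoints follow by continuity, since the closure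
of the complement of `[0,1]` is the complement of `(0,1)`. -/
theorem iteratedDeriv_unitBump_eq_zero (k : ℕ) {x : ℝ} (hx : x ∉ Ioo (0 : ℝ) 1) :
    iteratedDeriv k unitBump x = 0 := by
  have hcont : Continuous (iteratedDeriv k unitBump) :=
    (contDiff_unitBump (k := (k : ℕ∞))).continuous_iteratedDeriv k le_rfl
  have hout : ∀ y ∈ (Icc (0 : ℝ) 1)ᶜ, iteratedDeriv k unitBump y = 0 := by
    intro y hy
    have he : unitBump =ᶠ[𝓝 y] fun _ ↦ 0 := by
      filter_upwards [isClosed_Icc.isOpen_compl.mem_nhds hy] with z hz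
      exact unitBump_eq_zero fun h ↦ hz ⟨h.1.le, h.2.le⟩
    rw [he.iteratedDeriv_eq]
    simp
  have hcl : closure (Icc (0 : ℝ) 1)ᶜ = (Ioo (0 : ℝ) 1)ᶜ := by
    rw [closure_compl, interior_Icc]
  have hsub : closure (Icc (0 : ℝ) 1)ᶜ ⊆ {y | iteratedDeriv k unitBump y = 0} :=
    closure_minimal hout (isClosed_eq hcont continuous_const)
  exact hsub (hcl ▸ hx)

theorem exists_bound_iteratedDeriv_unitBump (k : ℕ) :
    ∃ M > 0, ∀ x, |iteratedDeriv k unitBump x| ≤ M := by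
  have hcont : Continuous (iteratedDeriv k unitBump) :=
    (contDiff_unitBump (k := (k : ℕ∞))).continuous_iteratedDeriv k le_rfl
  obtain ⟨C, hC⟩ := (isCompact_Icc (a := (0 : ℝ)) (b := 1)).exists_bound_of_continuousOn
    hcont.continuousOn
  refine ⟨max C 1, lt_max_of_lt_right one_pos, fun x ↦ ?_⟩
  by_cases hx : x ∈ Ioo (0 : ℝ) 1
  · exact (hC x ⟨hx.1.le, hx.2.le⟩).trans (le_max_left _ _)
  · rw [iteratedDeriv_unitBump_eq_zero k hx, abs_zero]
    exact le_max_of_le_right zero_le_one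

/-- The unit bump translated to the intervals `(k, k+1)` with `θ k = true`, summed up. -/
noncomputable def bumpSum {m : ℕ} (θ : Fin m → Bool) (y : ℝ) : ℝ :=
  ∑ k : Fin m, (if θ k then 1 else 0) * unitBump (y - (k : ℕ))

theorem sum_shift_eq_single {m : ℕ} (c : Fin m → ℝ) {F : ℝ → ℝ}
    (hF : ∀ x ∉ Ioo (0 : ℝ) 1, F x = 0) (y : ℝ) (k : Fin m)
    (hk : y - (k : ℕ) ∈ Ioo (0 : ℝ) 1) :
    ∑ j : Fin m, c j * F (y - (j : ℕ)) = c k * F (y - (k : ℕ)) := by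
  refine Finset.sum_eq_single k (fun j _ hj ↦ ?_) (by simp)
  rw [hF, mul_zero]
  intro h
  have h1 : ((j : ℕ) : ℝ) < (k : ℕ) + 1 := by linarith [h.1, hk.2]
  have h2 : ((k : ℕ) : ℝ) < (j : ℕ) + 1 := by linarith [h.2, hk.1]
  have h1' : (j : ℕ) < k + 1 := by exact_mod_cast h1
  have h2' : (k : ℕ) < j + 1 := by exact_mod_cast h2
  exact hj (Fin.ext (by omega))

theorem abs_sum_shift_le {m : ℕ} {c : Fin m → ℝ} (hc : ∀ k, |c k| ≤ 1) {F : ℝ → ℝ} {M : ℝ}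
    (hF : ∀ x ∉ Ioo (0 : ℝ) 1, F x = 0) (hM : ∀ x, |F x| ≤ M) (y : ℝ) :
    |∑ j : Fin m, c j * F (y - (j : ℕ))| ≤ M := by
  by_cases h : ∃ k : Fin m, y - (k : ℕ) ∈ Ioo (0 : ℝ) 1
  · obtain ⟨k, hk⟩ := h
    rw [sum_shift_eq_single c hF y k hk, abs_mul]
    exact (mul_le_of_le_one_left (abs_nonneg _) (hc k)).trans (hM _)
  · push Not at h
    rw [Finset.sum_eq_zero fun j _ ↦ by rw [hF _ (h j), mul_zero], abs_zero]
    exact (abs_nonneg _).trans (hM 0)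

theorem contDiff_bumpSum {m : ℕ} (θ : Fin m → Bool) {k : ℕ∞} : ContDiff ℝ k (bumpSum θ) :=
  ContDiff.sum fun _ _ ↦ contDiff_const.mul
    (contDiff_unitBump.comp (contDiff_id.sub contDiff_const))

theorem iteratedDeriv_bumpSum {m : ℕ} (θ : Fin m → Bool) (k : ℕ) (y : ℝ) :
    iteratedDeriv k (bumpSum θ) y =
      ∑ j : Fin m, (if θ j then 1 else 0) * iteratedDeriv k unitBump (y - (j : ℕ)) := by
  have hc : ∀ j : Fin m, ContDiff ℝ k fun y : ℝ ↦ unitBump (y - (j : ℕ)) := fun j ↦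
    (contDiff_unitBump (k := (k : ℕ∞))).comp (contDiff_id.sub contDiff_const)
  unfold bumpSum
  rw [iteratedDeriv_fun_sum fun j _ ↦ (contDiff_const.mul (hc j)).contDiffAt]
  refine Finset.sum_congr rfl fun j _ ↦ ?_
  rw [iteratedDeriv_const_mul _ (hc j).contDiffAt, iteratedDeriv_comp_sub_const]

theorem abs_iteratedDeriv_bumpSum_le {m : ℕ} (θ : Fin m → Bool) (k : ℕ) {M : ℝ}
    (hM : ∀ x, |iteratedDeriv k unitBump x| ≤ M) (y : ℝ) :
    |iteratedDeriv k (bumpSum θ) y| ≤ M := by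
  rw [iteratedDeriv_bumpSum]
  refine abs_sum_shift_le (fun j ↦ ?_) (fun x hx ↦ iteratedDeriv_unitBump_eq_zero k hx) hM y
  split_ifs <;> simp

/-- Interpolation between the Lipschitz bound for `|x - y| ≤ 1` and the sup bound for `|x - y| ≥ 1`.
Supports are disjoint, so the constant depends neither on `m` nor on `θ`. -/
theorem abs_sub_iteratedDeriv_bumpSum_le {m : ℕ} (θ : Fin m → Bool) (k : ℕ) {M M' : ℝ}
    (hM : ∀ x, |iteratedDeriv k unitBump x| ≤ M)
    (hM' : ∀ x, |iteratedDeriv (k + 1) unitBump x| ≤ M') {b : ℝ} (hb0 : 0 ≤ b) (hb1 : b ≤ 1)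
    (x y : ℝ) :
    |iteratedDeriv k (bumpSum θ) x - iteratedDeriv k (bumpSum θ) y| ≤
      (2 * M + M') * |x - y| ^ b := by
  have hM0 : 0 ≤ M := (abs_nonneg _).trans (hM 0)
  have hM0' : 0 ≤ M' := (abs_nonneg _).trans (hM' 0)
  have hdiff : Differentiable ℝ (iteratedDeriv k (bumpSum θ)) :=
    (contDiff_bumpSum θ (k := ((k + 1 : ℕ) : ℕ∞))).differentiable_iteratedDeriv k
      (by exact_mod_cast Nat.lt_succ_self k)
  have hlip : |iteratedDeriv k (bumpSum θ) x - iteratedDeriv k (bumpSum θ) y| ≤ M' * |x - y| := by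
    have := Convex.norm_image_sub_le_of_norm_deriv_le (f := iteratedDeriv k (bumpSum θ))
      (C := M') (s := univ) (x := y) (y := x) (fun z _ ↦ hdiff z) (fun z _ ↦ by
        rw [← iteratedDeriv_succ]
        exact abs_iteratedDeriv_bumpSum_le θ (k + 1) hM' z) convex_univ (mem_univ _) (mem_univ _)
    simpa using this
  have hbd : |iteratedDeriv k (bumpSum θ) x - iteratedDeriv k (bumpSum θ) y| ≤ 2 * M := by
    have h1 := abs_iteratedDeriv_bumpSum_le θ k hM x
    have h2 := abs_iteratedDeriv_bumpSum_le θ k hM y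
    have := abs_sub (iteratedDeriv k (bumpSum θ) x) (iteratedDeriv k (bumpSum θ) y)
    linarith
  have hr : 0 ≤ |x - y| ^ b := Real.rpow_nonneg (abs_nonneg _) _
  rcases le_total |x - y| 1 with h | h
  · have h1 : |x - y| ≤ |x - y| ^ b := by
      simpa using Real.rpow_le_rpow_of_exponent_ge_of_imp (abs_nonneg (x - y)) h hb1
        (fun h0 h1 ↦ by simp at h1)
    calc _ ≤ M' * |x - y| := hlip
      _ ≤ M' * |x - y| ^ b := by gcongr
      _ ≤ (2 * M + M') * |x - y| ^ b := by gcongr; linarith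
  · have h1 : 1 ≤ |x - y| ^ b := Real.one_le_rpow h hb0
    calc _ ≤ 2 * M * 1 := by linarith
      _ ≤ 2 * M * |x - y| ^ b := by gcongr
      _ ≤ (2 * M + M') * |x - y| ^ b := by gcongr; linarith

/-- The vertex `θ` of the hypercube: `l` plus bumps of height of order `A` on the intervals
`(k/m, (k+1)/m)` with `θ k = true`. -/
noncomputable def cubeFun (l A : ℝ) {m : ℕ} (θ : Fin m → Bool) (t : ℝ) : ℝ :=
  l + A * bumpSum θ (m * t)

theorem contDiff_cubeFun (l A : ℝ) {m : ℕ} (θ : Fin m → Bool) {k : ℕ∞} :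
    ContDiff ℝ k (cubeFun l A θ) :=
  contDiff_const.add (contDiff_const.mul
    ((contDiff_bumpSum θ).comp (contDiff_const.mul contDiff_id)))

theorem bumpSum_nonneg {m : ℕ} (θ : Fin m → Bool) (y : ℝ) : 0 ≤ bumpSum θ y := by
  refine Finset.sum_nonneg fun k _ ↦ mul_nonneg ?_ (unitBump_nonneg _)
  split_ifs <;> simp

theorem bumpSum_le_one {m : ℕ} (θ : Fin m → Bool) (y : ℝ) : bumpSum θ y ≤ 1 := by
  have := abs_iteratedDeriv_bumpSum_le θ 0 (M := 1)
    (fun x ↦ by simpa [abs_of_nonneg (unitBump_nonneg x)] using unitBump_le_one x) y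
  rw [iteratedDeriv_zero] at this
  exact (le_abs_self _).trans this

theorem le_cubeFun {l A : ℝ} (hA : 0 ≤ A) {m : ℕ} (θ : Fin m → Bool) (t : ℝ) :
    l ≤ cubeFun l A θ t := by
  have := mul_nonneg hA (bumpSum_nonneg θ (m * t))
  unfold cubeFun; linarith

theorem cubeFun_le {l A : ℝ} (hA : 0 ≤ A) {m : ℕ} (θ : Fin m → Bool) (t : ℝ) :
    cubeFun l A θ t ≤ l + A := by
  have := mul_le_of_le_one_right hA (bumpSum_le_one θ (m * t))
  unfold cubeFun; linarith

theorem iteratedDeriv_cubeFun_sub (l A : ℝ) {m : ℕ} (θ : Fin m → Bool) (k : ℕ) (x y : ℝ) :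
    iteratedDeriv k (cubeFun l A θ) x - iteratedDeriv k (cubeFun l A θ) y =
      A * (m : ℝ) ^ k * (iteratedDeriv k (bumpSum θ) (m * x) -
        iteratedDeriv k (bumpSum θ) (m * y)) := by
  have hb := contDiff_bumpSum θ (k := (k : ℕ∞))
  have hs : ∀ x, iteratedDeriv k (fun t ↦ A * bumpSum θ (m * t)) x =
      A * ((m : ℝ) ^ k * iteratedDeriv k (bumpSum θ) (m * x)) := by
    intro x
    have hc : ContDiff ℝ k fun t : ℝ ↦ bumpSum θ (m * t) :=
      hb.comp (contDiff_const.mul contDiff_id)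
    rw [iteratedDeriv_const_mul _ hc.contDiffAt, iteratedDeriv_comp_const_mul hb]
  have h : iteratedDeriv k (cubeFun l A θ) x - iteratedDeriv k (cubeFun l A θ) y =
      iteratedDeriv k (fun t ↦ A * bumpSum θ (m * t)) x -
        iteratedDeriv k (fun t ↦ A * bumpSum θ (m * t)) y := by
    rcases Nat.eq_zero_or_pos k with rfl | hk
    · simp [cubeFun]
    · unfold cubeFun
      rw [iteratedDeriv_const_add hk, iteratedDeriv_const_add hk]
  rw [h, hs, hs]; ring

/-- Small hypercubes are contained in the function class. -/
theorem exists_cubeFun_mem_boundedHolder {α L l u : ℝ} (hα : 0 ≤ α) (hL : 0 < L) (hlu : l < u) :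
    ∃ c₀ > 0, ∀ c, 0 ≤ c → c ≤ c₀ → ∀ m : ℕ, 0 < m → ∀ θ : Fin m → Bool,
      cubeFun l (c * (m : ℝ) ^ (-α)) θ ∈ boundedHolder α L l u := by
  obtain ⟨M, hM0, hM⟩ := exists_bound_iteratedDeriv_unitBump ⌊α⌋₊
  obtain ⟨M', hM0', hM'⟩ := exists_bound_iteratedDeriv_unitBump (⌊α⌋₊ + 1)
  have hB : 0 < 2 * M + M' := by positivity
  refine ⟨min (L / (2 * M + M')) (u - l), lt_min (by positivity) (by linarith), ?_⟩
  intro c hc0 hc m hm θ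
  have hm' : (0 : ℝ) < m := by exact_mod_cast hm
  have hm1 : (1 : ℝ) ≤ m := by exact_mod_cast hm
  have hA : 0 ≤ c * (m : ℝ) ^ (-α) := by positivity
  have hAc : c * (m : ℝ) ^ (-α) ≤ c :=
    mul_le_of_le_one_right hc0 (Real.rpow_le_one_of_one_le_of_nonpos hm1 (by linarith))
  have hU : UniqueDiffOn ℝ (Icc (0 : ℝ) 1) := uniqueDiffOn_Icc zero_lt_one
  have heq : ∀ k, ∀ x ∈ Icc (0 : ℝ) 1,
      iteratedDerivWithin k (cubeFun l (c * (m : ℝ) ^ (-α)) θ) (Icc 0 1) x =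
        iteratedDeriv k (cubeFun l (c * (m : ℝ) ^ (-α)) θ) x := fun k x hx ↦
    iteratedDerivWithin_eq_iteratedDeriv hU
      (contDiff_cubeFun l _ θ (k := (k : ℕ∞))).contDiffAt hx
  refine ⟨fun k _ ↦ ?_, fun x hx y hy ↦ ?_, fun x _ ↦ ⟨le_cubeFun hA θ x, ?_⟩⟩
  · have hf := contDiff_cubeFun l (c * (m : ℝ) ^ (-α)) θ (k := ((k + 1 : ℕ) : ℕ∞))
    exact hf.contDiffOn.differentiableOn_iteratedDerivWithin
      (by exact_mod_cast Nat.lt_succ_self k) hU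
  · rw [heq _ x hx, heq _ y hy, iteratedDeriv_cubeFun_sub, abs_mul, abs_of_nonneg (by positivity)]
    have hb0 : 0 ≤ α - (⌊α⌋₊ : ℝ) := by linarith [Nat.floor_le hα]
    have hb1 : α - (⌊α⌋₊ : ℝ) ≤ 1 := by linarith [Nat.lt_floor_add_one α]
    have h := abs_sub_iteratedDeriv_bumpSum_le θ ⌊α⌋₊ hM hM' hb0 hb1 (m * x) (m * y)
    rw [← mul_sub, abs_mul, abs_of_pos hm', Real.mul_rpow hm'.le (abs_nonneg _)] at h
    refine (mul_le_mul_of_nonneg_left h (by positivity)).trans ?_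
    -- Amplitude, derivatives and Hölder quotient scale with exponents that cancel: this is why the
    -- height is `m^(-α)`.
    have e : (m : ℝ) ^ (-α) * (m : ℝ) ^ ⌊α⌋₊ * (m : ℝ) ^ (α - (⌊α⌋₊ : ℝ)) = 1 := by
      rw [← Real.rpow_natCast, ← Real.rpow_add hm', ← Real.rpow_add hm']
      simp
    have hcL : c * (2 * M + M') ≤ L := by
      rw [← le_div_iff₀ hB]; exact hc.trans (min_le_left _ _)
    calc _ = c * (2 * M + M') * |x - y| ^ (α - (⌊α⌋₊ : ℝ)) *
          ((m : ℝ) ^ (-α) * (m : ℝ) ^ ⌊α⌋₊ * (m : ℝ) ^ (α - (⌊α⌋₊ : ℝ))) := by ring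
      _ ≤ _ := by
        rw [e, mul_one]
        exact mul_le_mul_of_nonneg_right hcL (Real.rpow_nonneg (abs_nonneg _) _)
  · have := cubeFun_le (l := l) hA θ x
    have := hc.trans (min_le_right _ _)
    linarith

/-- The bump which distinguishes two neighbouring vertices. -/
noncomputable def cubeBump (A : ℝ) (m k : ℕ) (t : ℝ) : ℝ := A * unitBump (m * t - k)

theorem cubeFun_update {l A : ℝ} {m : ℕ} {θ : Fin m → Bool} {k : Fin m} (hk : θ k = false)
    (t : ℝ) : cubeFun l A (Function.update θ k true) t = cubeFun l A θ t + cubeBump A m k t := by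
  have h : bumpSum (Function.update θ k true) (m * t) =
      bumpSum θ (m * t) + unitBump (m * t - (k : ℕ)) := by
    unfold bumpSum
    rw [← Finset.add_sum_erase _ _ (Finset.mem_univ k),
      ← Finset.add_sum_erase _ (fun j : Fin m ↦ (if θ j then (1 : ℝ) else 0) *
        unitBump (m * t - (j : ℕ))) (Finset.mem_univ k)]
    rw [Finset.sum_congr rfl (g := fun j : Fin m ↦ (if θ j then (1 : ℝ) else 0) *
        unitBump (m * t - (j : ℕ)))]
    · simp [hk]; ring
    · intro j hj
      rw [Function.update_of_ne (Finset.ne_of_mem_erase hj)]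
  rw [cubeFun, h, cubeFun, cubeBump]; ring

theorem cubeFun_eq_of_mem {l A : ℝ} {m : ℕ} {θ : Fin m → Bool} {k : Fin m} (hk : θ k = false)
    {t : ℝ} (ht : (m : ℝ) * t - (k : ℕ) ∈ Ioo (0 : ℝ) 1) : cubeFun l A θ t = l := by
  have := sum_shift_eq_single (fun k ↦ if θ k then (1 : ℝ) else 0)
    (fun x hx ↦ unitBump_eq_zero hx) (m * t) k ht
  simp only [cubeFun, bumpSum, this, hk]
  simp

theorem cubeBump_eq_zero {A : ℝ} {m k : ℕ} {t : ℝ} (ht : (m : ℝ) * t - k ∉ Ioo (0 : ℝ) 1) :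
    cubeBump A m k t = 0 := by
  rw [cubeBump, unitBump_eq_zero ht, mul_zero]

theorem cubeBump_nonneg {A : ℝ} (hA : 0 ≤ A) (m k : ℕ) (t : ℝ) : 0 ≤ cubeBump A m k t :=
  mul_nonneg hA (unitBump_nonneg _)

theorem cubeBump_le {A : ℝ} (hA : 0 ≤ A) (m k : ℕ) (t : ℝ) : cubeBump A m k t ≤ A :=
  mul_le_of_le_one_right hA (unitBump_le_one _)

theorem exists_lipschitz_cubeBump : ∃ M > 0, ∀ A, 0 ≤ A → ∀ (m k : ℕ) (x y : ℝ),
    |cubeBump A m k x - cubeBump A m k y| ≤ A * m * M * |x - y| := by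
  obtain ⟨M, hM0, hM⟩ := exists_bound_iteratedDeriv_unitBump 1
  refine ⟨M, hM0, fun A hA m k x y ↦ ?_⟩
  have h := Convex.norm_image_sub_le_of_norm_deriv_le (f := unitBump) (C := M) (s := univ)
    (x := m * y - k) (y := m * x - k)
    (fun z _ ↦ (contDiff_unitBump (k := 1)).differentiable (by simp) z)
    (fun z _ ↦ by rw [← iteratedDeriv_one]; exact hM z) convex_univ (mem_univ _) (mem_univ _)
  rw [Real.norm_eq_abs, Real.norm_eq_abs, show (m : ℝ) * x - k - (m * y - k) = m * (x - y) by ring,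
    abs_mul, Nat.abs_cast] at h
  rw [cubeBump, cubeBump, ← mul_sub, abs_mul, abs_of_nonneg hA]
  calc _ ≤ A * (M * (m * |x - y|)) := by gcongr
    _ = _ := by ring

end Bumps

end VolatilityModel

namespace VolatilityModel

/-! ### Neighbouring vertices cannot be separated -/

section Neighbours

open Classical in
/-- The indices `j` for which `[j/n, (j+1)/n]` meets the interval `(k/m, (k+1)/m)`. -/
noncomputable def blockIndices (n m k : ℕ) : Finset (Fin n) :=
  Finset.univ.filter fun j ↦ (k : ℝ) * n < m * (j + 1) ∧ (m : ℝ) * j < (k + 1) * n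

theorem mem_blockIndices {n m k : ℕ} {j : Fin n} :
    j ∈ blockIndices n m k ↔ (k : ℝ) * n < m * (j + 1) ∧ (m : ℝ) * j < (k + 1) * n := by
  simp [blockIndices]

/-- An interval of length `1/m` meets at most `n/m + 2` cells, and `m ≤ n` absorbs the `2`. -/
theorem card_blockIndices_le {n m : ℕ} (hm : 0 < m) (hmn : m ≤ n) (k : ℕ) :
    ((blockIndices n m k).card : ℝ) ≤ 3 * n / m := by
  have hm' : (0 : ℝ) < m := by exact_mod_cast hm
  have hmn' : (m : ℝ) ≤ n := by exact_mod_cast hmn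
  set a : ℝ := k * n / m with ha
  set b : ℝ := (k + 1) * n / m with hb
  have hab : b - a = n / m := by rw [ha, hb]; ring
  have hsub : (blockIndices n m k).map Fin.valEmbedding ⊆ Finset.Ico ⌊a⌋₊ ⌈b⌉₊ := by
    intro x hx
    obtain ⟨j, hj, rfl⟩ := Finset.mem_map.1 hx
    obtain ⟨h1, h2⟩ := mem_blockIndices.1 hj
    rw [Finset.mem_Ico, Fin.valEmbedding_apply]
    constructor
    · have : a < ((j : ℕ) + 1 : ℕ) := by
        rw [ha, div_lt_iff₀ hm']; push_cast; linarith
      exact Nat.lt_succ_iff.1 ((Nat.floor_lt (by positivity)).2 this)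
    · rw [Nat.lt_ceil, hb, lt_div_iff₀ hm']; linarith
  have hcard := Finset.card_le_card hsub
  rw [Finset.card_map, Nat.card_Ico] at hcard
  have hab0 : 0 ≤ (n : ℝ) / m := by positivity
  have hle : ⌊a⌋₊ ≤ ⌈b⌉₊ := by
    have h1 : (⌊a⌋₊ : ℝ) ≤ a := Nat.floor_le (by positivity)
    have h2 : b ≤ (⌈b⌉₊ : ℝ) := Nat.le_ceil b
    have : (⌊a⌋₊ : ℝ) ≤ ⌈b⌉₊ := by linarith
    exact_mod_cast this
  have hcard' : ((blockIndices n m k).card : ℝ) ≤ ⌈b⌉₊ - ⌊a⌋₊ := by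
    rw [← Nat.cast_sub hle]; exact_mod_cast hcard
  have h1 : a < ⌊a⌋₊ + 1 := Nat.lt_floor_add_one a
  have h2 : (⌈b⌉₊ : ℝ) < b + 1 := Nat.ceil_lt_add_one (by positivity)
  have h3 : 1 ≤ (n : ℝ) / m := by rwa [one_le_div hm']
  have h4 : 3 * (n : ℝ) / m = 3 * (n / m) := by ring
  linarith

theorem sum_le_of_blockIndices {n m : ℕ} (hm : 0 < m) (hmn : m ≤ n) (k : ℕ) {v : Fin n → ℝ}
    {V : ℝ} (hV : 0 ≤ V) (h0 : ∀ j ∉ blockIndices n m k, v j = 0) (hv : ∀ j, v j ≤ V) :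
    ∑ j, v j ≤ 3 * n / m * V := by
  rw [← Finset.sum_subset (Finset.subset_univ (blockIndices n m k)) fun j _ hj ↦ h0 j hj]
  refine (Finset.sum_le_card_nsmul _ _ V fun j _ ↦ hv j).trans ?_
  rw [nsmul_eq_mul]
  exact mul_le_mul_of_nonneg_right (card_blockIndices_le hm hmn k) hV

theorem cubeBump_eq_zero_of_notMem {A : ℝ} {n m k : ℕ} {j : Fin n} (hj : j ∉ blockIndices n m k)
    {t : ℝ} (h1 : (j : ℝ) / n ≤ t) (h2 : t ≤ ((j : ℝ) + 1) / n) : cubeBump A m k t = 0 := by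
  have hn : (0 : ℝ) < n := by exact_mod_cast (Nat.zero_le _).trans_lt j.2
  refine cubeBump_eq_zero fun h ↦ hj (mem_blockIndices.2 ?_)
  rw [div_le_iff₀ hn] at h1
  rw [le_div_iff₀ hn] at h2
  have hm : (0 : ℝ) ≤ m := by positivity
  have h3 : (k : ℝ) < m * t := by linarith [h.1]
  have h4 : (m : ℝ) * t < k + 1 := by linarith [h.2]
  constructor
  · calc (k : ℝ) * n < m * t * n := by gcongr
      _ = m * (t * n) := by ring
      _ ≤ _ := by gcongr
  · calc (m : ℝ) * j ≤ m * (t * n) := by gcongr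
      _ = m * t * n := by ring
      _ < _ := by gcongr

theorem sqrt_add_sub_sqrt_le {x d y : ℝ} (hy : 0 < y) (hyx : y ≤ x) (hd : 0 ≤ d) :
    (√(x + d) - √x) ^ 2 ≤ d ^ 2 / (4 * y) := by
  have hx : 0 < x := hy.trans_le hyx
  have h1 : (√(x + d) - √x) * (√(x + d) + √x) = d := by
    have a1 := Real.mul_self_sqrt hx.le
    have a2 := Real.mul_self_sqrt (by linarith : 0 ≤ x + d)
    linear_combination a2 - a1
  have h2 : √y ≤ √x := Real.sqrt_le_sqrt hyx
  have h3 : √x ≤ √(x + d) := Real.sqrt_le_sqrt (by linarith)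
  have h4 : 0 < √y := Real.sqrt_pos.2 hy
  rw [le_div_iff₀ (by positivity)]
  calc (√(x + d) - √x) ^ 2 * (4 * y) = (√(x + d) - √x) ^ 2 * (2 * √y) ^ 2 := by
        rw [mul_pow, Real.sq_sqrt hy.le]; norm_num
    _ ≤ (√(x + d) - √x) ^ 2 * (√(x + d) + √x) ^ 2 := by gcongr; linarith
    _ = d ^ 2 := by rw [← mul_pow, h1]

theorem abs_sqrt_one_add_sub_le {x y : ℝ} (hx : 0 ≤ x) (hy : 0 ≤ y) :
    |√(1 + x) - √(1 + y)| ≤ |x - y| / 2 := by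
  have h1 : (√(1 + x) - √(1 + y)) * (√(1 + x) + √(1 + y)) = x - y := by
    have a1 := Real.mul_self_sqrt (by linarith : 0 ≤ 1 + x)
    have a2 := Real.mul_self_sqrt (by linarith : 0 ≤ 1 + y)
    linear_combination a1 - a2
  have h2 : 1 ≤ √(1 + x) := Real.one_le_sqrt.2 (by linarith)
  have h3 : 1 ≤ √(1 + y) := Real.one_le_sqrt.2 (by linarith)
  rw [← h1, abs_mul, abs_of_nonneg (by positivity : 0 ≤ √(1 + x) + √(1 + y))]
  nlinarith [abs_nonneg (√(1 + x) - √(1 + y))]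

variable {Ω : Type*} [MeasurableSpace Ω] {P : Measure Ω} {W : ℝ≥0 → Ω → ℝ}

/-- The bump changes only the standard deviations of the increments. About `n/m` of them change,
each by a square of order `A²/n`, so `S` is of order `A²/m`. -/
theorem two_point_obsIntegral (hW : IsPreBrownianReal W P) {n m K : ℕ} (hm : 0 < m) (hmn : m ≤ n)
    (hK0 : √n ≤ K) (hK1 : K ≤ 2 * √n) {l A τ : ℝ} (hl : 0 < l) (hA : 0 ≤ A) (hτ : 0 < τ)
    (hle : A ^ 2 * √n / m * (3 / (4 * l) * (2 / l + 2 / τ ^ 2)) ≤ 1)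
    {θ : Fin m → Bool} {k : Fin m} (hk : θ k = false) {ε : Fin n → Ω → ℝ}
    (hε : ∀ i, HasLaw (ε i) (gaussianReal 0 1) P) (hi : iIndepFun ε P)
    (hind : IndepFun (fun ω t ↦ W t ω) (fun ω i ↦ ε i ω) P)
    {F G : (Fin n → ℝ) → ℝ≥0∞} (hF : Measurable F) (hG : Measurable G) {D : ℝ≥0∞}
    (hD : ∀ y, D ≤ F y + G y) :
    D * ENNReal.ofReal (1 / 4) ≤
      ∫⁻ ω, F (obsIntegral P W τ ε (cubeFun l A θ) ω) ∂P +
        ∫⁻ ω, G (obsIntegral P W τ ε (cubeFun l A (Function.update θ k true)) ω) ∂P := by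
  have hn : 0 < n := hm.trans_le hmn
  have hn' : (0 : ℝ) < n := by exact_mod_cast hn
  have hm' : (0 : ℝ) < m := by exact_mod_cast hm
  have hsn : 0 < √(n : ℝ) := Real.sqrt_pos.2 hn'
  have hK' : (0 : ℝ) < K := hsn.trans_le hK0
  have hK : 0 < K := by exact_mod_cast hK'
  have hcont : ∀ θ : Fin m → Bool, Continuous (cubeFun l A θ) := fun θ ↦
    (contDiff_cubeFun l A θ (k := 0)).continuous
  have hcb : Continuous (cubeBump A m k) :=
    continuous_const.mul ((contDiff_unitBump (k := 0)).continuous.comp (by fun_prop))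
  have hjj : ∀ j : Fin n, (j : ℝ) / n ≤ ((j : ℝ) + 1) / n := fun j ↦ by gcongr; linarith
  set d : (Fin m → Bool) → Fin n → ℝ := fun θ j ↦
    ∫ x in Ioc ((j : ℝ) / n) ((j + 1 : ℝ) / n), cubeFun l A θ x with hd
  set e : Fin n → ℝ := fun j ↦ ∫ x in Ioc ((j : ℝ) / n) ((j + 1 : ℝ) / n), cubeBump A m k x with he
  have hvol : ∀ j : Fin n, (volume : Measure ℝ).real (Ioc ((j : ℝ) / n) ((j + 1 : ℝ) / n)) =
      1 / n := by
    intro j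
    rw [Real.volume_real_Ioc_of_le (hjj j)]; ring
  have hdl : ∀ θ j, l / n ≤ d θ j := by
    intro θ j
    have h := setIntegral_mono_on (μ := volume) (s := Ioc ((j : ℝ) / n) ((j + 1 : ℝ) / n))
      (f := fun _ ↦ l) (g := cubeFun l A θ) (integrableOn_const (by simp))
      ((hcont θ).integrableOn_Ioc) measurableSet_Ioc fun x _ ↦ le_cubeFun hA θ x
    rw [setIntegral_const, hvol, smul_eq_mul] at h
    calc l / n = 1 / n * l := by ring
      _ ≤ _ := h
  have he0 : ∀ j, 0 ≤ e j := fun j ↦ integral_nonneg fun x ↦ cubeBump_nonneg hA _ _ x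
  have heA : ∀ j, e j ≤ A / n := by
    intro j
    have h := setIntegral_mono_on (μ := volume) (s := Ioc ((j : ℝ) / n) ((j + 1 : ℝ) / n))
      (f := cubeBump A m k) (g := fun _ ↦ A) (hcb.integrableOn_Ioc)
      (integrableOn_const (by simp)) measurableSet_Ioc fun x _ ↦ cubeBump_le hA _ _ x
    rw [setIntegral_const, hvol, smul_eq_mul] at h
    calc e j ≤ 1 / n * A := h
      _ = _ := by ring
  have heb : ∀ j ∉ blockIndices n m k, e j = 0 := by
    intro j hj
    refine setIntegral_eq_zero_of_forall_eq_zero fun x hx ↦ ?_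
    exact cubeBump_eq_zero_of_notMem hj hx.1.le hx.2
  have hde : ∀ j, d (Function.update θ k true) j = d θ j + e j := by
    intro j
    simp only [hd, he, cubeFun_update hk]
    exact integral_add (hcont θ).integrableOn_Ioc hcb.integrableOn_Ioc
  have hd0 : ∀ θ j, 0 < d θ j := fun θ j ↦ (by positivity : 0 < l / n).trans_le (hdl θ j)
  have hlaw : ∀ θ : Fin m → Bool, ∀ F : (Fin n → ℝ) → ℝ≥0∞, Measurable F →
      ∫⁻ ω, F (obsIntegral P W τ ε (cubeFun l A θ) ω) ∂P =
        ∫⁻ x, F (obsMap (fun _ ↦ 1) (fun j ↦ √(d θ j)) τ x) ∂(stdGaussianPi (Fin n ⊕ Fin n)) :=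
    fun θ F hF ↦ lintegral_obsIntegral hW hn (hcont θ).continuousOn
      (fun x _ ↦ hl.le.trans (le_cubeFun hA θ x)) (fun j ↦ Real.sqrt_pos.2 (hd0 θ j))
      (fun j ↦ Real.sq_sqrt (hd0 θ j).le) hε hi hind τ hF
  rw [hlaw θ F hF, hlaw _ G hG]
  set r : Fin n → ℝ := fun j ↦ √(d (Function.update θ k true) j) - √(d θ j) with hr
  have hr2 : ∀ j, r j ^ 2 ≤ A ^ 2 / (4 * l * n) := by
    intro j
    simp only [hr, hde]
    refine (sqrt_add_sub_sqrt_le (by positivity) (hdl θ j) (he0 j)).trans ?_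
    calc e j ^ 2 / (4 * (l / n)) ≤ (A / n) ^ 2 / (4 * (l / n)) := by
          gcongr
          · exact he0 j
          · exact heA j
      _ = _ := by field_simp
  have hS : ∑ j, r j ^ 2 ≤ A ^ 2 / m * (3 / (4 * l)) := by
    refine (sum_le_of_blockIndices hm hmn k (by positivity) (fun j hj ↦ ?_) hr2).trans
      (le_of_eq ?_)
    · simp only [hr, hde, heb j hj]; simp
    · field_simp
  have hS0 : 0 ≤ ∑ j, r j ^ 2 := Finset.sum_nonneg fun j _ ↦ sq_nonneg _
  -- `Q` depends on the column only, so its row variation is zero.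
  refine two_point_obsMap hK (Q := fun _ j ↦ r j) hτ.ne' (fun i j ↦ by simp [hr])
    (v := l / n) (A := 1) (by positivity) (fun p ↦ ?_) (fun i ↦ by simp) (α := fun _ ↦ 0)
    (β := fun j ↦ r j ^ 2) (fun _ ↦ le_rfl) (fun j ↦ sq_nonneg _) (fun p j ↦ by simp) ?_ hF hG hD
  · rw [Real.sq_sqrt (hd0 θ p).le]; exact hdl θ p
  · simp only [Finset.sum_const_zero, zero_add, sub_self, ne_eq, OfNat.ofNat_ne_zero,
      not_false_eq_true, zero_pow, add_zero]
    set S := ∑ j, r j ^ 2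
    have h1 : S / K ≤ S / √n := by gcongr
    have h2 : (n : ℝ) / √n = √n := Real.div_sqrt
    calc 2 / (l / n) * (S / K) + 1 / τ ^ 2 * (K * S)
        ≤ 2 / (l / n) * (S / √n) + 1 / τ ^ 2 * (2 * √n * S) := by gcongr
      _ = 2 / l * S * (n / √n) + 1 / τ ^ 2 * (2 * √n * S) := by field_simp
      _ = S * √n * (2 / l + 2 / τ ^ 2) := by rw [h2]; ring
      _ ≤ A ^ 2 / m * (3 / (4 * l)) * √n * (2 / l + 2 / τ ^ 2) := by gcongr
      _ = A ^ 2 * √n / m * (3 / (4 * l) * (2 / l + 2 / τ ^ 2)) := by ring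
      _ ≤ 1 := hle

/-- The bump changes the outer factors, so `Q` depends on the row only. Its variation between rows,
bounded through the Lipschitz constant of the bump, produces the extra term `A² m`. -/
theorem two_point_obsProduct (hW : IsPreBrownianReal W P) {n m K : ℕ} (hm : 0 < m) (hmn : m ≤ n)
    (hK0 : √n ≤ K) (hK1 : K ≤ 2 * √n) {l A τ u M : ℝ} (hl : 0 < l) (hA : 0 ≤ A) (hτ : 0 < τ)
    (hM : 0 ≤ M) (hMA : ∀ (k : ℕ) (x y : ℝ),
      |cubeBump A m k x - cubeBump A m k y| ≤ A * m * M * |x - y|) (hu : l + A ≤ u)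
    (hle : A ^ 2 * √n / m * (3 / (4 * l ^ 2) * (2 + 2 * u / τ ^ 2)) +
      A ^ 2 * m * (3 * M ^ 2 / (2 * l ^ 2)) ≤ 1)
    {θ : Fin m → Bool} {k : Fin m} (hk : θ k = false) {ε : Fin n → Ω → ℝ}
    (hε : ∀ i, HasLaw (ε i) (gaussianReal 0 1) P) (hi : iIndepFun ε P)
    (hind : IndepFun (fun ω t ↦ W t ω) (fun ω i ↦ ε i ω) P)
    {F G : (Fin n → ℝ) → ℝ≥0∞} (hF : Measurable F) (hG : Measurable G) {D : ℝ≥0∞}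
    (hD : ∀ y, D ≤ F y + G y) :
    D * ENNReal.ofReal (1 / 4) ≤
      ∫⁻ ω, F (obsProduct W τ ε (cubeFun l A θ) ω) ∂P +
        ∫⁻ ω, G (obsProduct W τ ε (cubeFun l A (Function.update θ k true)) ω) ∂P := by
  have hn : 0 < n := hm.trans_le hmn
  have hn' : (0 : ℝ) < n := by exact_mod_cast hn
  have hm' : (0 : ℝ) < m := by exact_mod_cast hm
  have hu0 : 0 ≤ u := by linarith
  have hsn : 0 < √(n : ℝ) := Real.sqrt_pos.2 hn'
  have hK' : (0 : ℝ) < K := hsn.trans_le hK0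
  have hK : 0 < K := by exact_mod_cast hK'
  rw [lintegral_obsProduct hW hn _ hε hi hind τ hF, lintegral_obsProduct hW hn _ hε hi hind τ hG]
  set ψ : ℝ → ℝ := cubeBump A m k with hψ
  have hψ0 : ∀ x, 0 ≤ ψ x := cubeBump_nonneg hA _ _
  set q : ℕ → ℝ := fun i ↦ √(1 + ψ ((i + 1 : ℝ) / n) / l) - 1 with hq
  -- Where the new bump is nonzero the unperturbed function equals `l`, so the relative change is
  -- `√(1 + ψ / l)` and does not depend on the other bumps.
  have hfac : ∀ x, √(cubeFun l A (Function.update θ k true) x) =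
      √(cubeFun l A θ x) * √(1 + ψ x / l) := by
    intro x
    rw [cubeFun_update hk, ← Real.sqrt_mul (hl.le.trans (le_cubeFun hA θ x))]
    congr 1
    by_cases hx : (m : ℝ) * x - (k : ℕ) ∈ Ioo (0 : ℝ) 1
    · rw [cubeFun_eq_of_mem hk hx]; field_simp; rfl
    · rw [hψ, cubeBump_eq_zero hx]; simp
  have hq0 : ∀ i : ℕ, q i ^ 2 ≤ (A / (2 * l)) ^ 2 := by
    intro i
    have h1 := abs_sqrt_one_add_sub_le (x := ψ ((i + 1 : ℝ) / n) / l) (y := 0)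
      (div_nonneg (hψ0 _) hl.le) le_rfl
    rw [add_zero, Real.sqrt_one, sub_zero, abs_of_nonneg (div_nonneg (hψ0 _) hl.le)] at h1
    rw [← sq_abs]
    have h2 : ψ ((i + 1 : ℝ) / n) / l / 2 ≤ A / (2 * l) := by
      rw [div_div, mul_comm 2 l]
      gcongr
      exact cubeBump_le hA _ _ _
    exact pow_le_pow_left₀ (abs_nonneg _) (h1.trans h2) 2
  have hqd : ∀ i : ℕ, (q i - q (i - 1)) ^ 2 ≤ (A * m * M / (2 * l * n)) ^ 2 := by
    intro i
    rw [← sq_abs]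
    refine pow_le_pow_left₀ (abs_nonneg _) ?_ 2
    have e : q i - q (i - 1) = √(1 + ψ ((i + 1 : ℝ) / n) / l) -
        √(1 + ψ (((i - 1 : ℕ) + 1 : ℝ) / n) / l) := by simp only [hq]; ring
    rw [e]
    refine (abs_sqrt_one_add_sub_le (div_nonneg (hψ0 _) hl.le) (div_nonneg (hψ0 _) hl.le)).trans ?_
    rw [← sub_div, abs_div, abs_of_pos hl]
    have h1 := hMA k ((i + 1 : ℝ) / n) (((i - 1 : ℕ) + 1 : ℝ) / n)
    have h2 : |(i + 1 : ℝ) / n - ((i - 1 : ℕ) + 1 : ℝ) / n| ≤ 1 / n := by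
      rcases i with _ | i
      · simp
      · rw [← sub_div, abs_div, abs_of_pos hn']
        push_cast
        gcongr
        simp
    calc _ ≤ A * m * M * (1 / n) / l / 2 := by
          gcongr
          exact h1.trans (by gcongr)
      _ = _ := by field_simp
  have hqb : ∀ j : Fin n, j ∉ blockIndices n m k → q j = 0 := by
    intro j hj
    have : ψ (((j : ℕ) + 1 : ℝ) / n) = 0 :=
      cubeBump_eq_zero_of_notMem hj (by gcongr; linarith) le_rfl
    simp [hq, this]
  -- `blockIndices` is defined with closed cells, so outside it the bump vanishes at both endpoints
  -- of the cell.
  have hqb' : ∀ j : Fin n, j ∉ blockIndices n m k → q j - q (j - 1) = 0 := by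
    intro j hj
    rw [hqb j hj, zero_sub, neg_eq_zero]
    rcases Nat.eq_zero_or_pos (j : ℕ) with h0 | h0
    · have := hqb j hj
      rw [h0] at this ⊢
      exact this
    · have hc : (((j : ℕ) - 1 : ℕ) + 1 : ℝ) = (j : ℕ) := by
        rw [Nat.cast_sub h0]; simp
      have : ψ ((((j : ℕ) - 1 : ℕ) + 1 : ℝ) / n) = 0 := by
        rw [hc]
        exact cubeBump_eq_zero_of_notMem hj le_rfl (by gcongr; linarith)
      simp only [hq, this]; simp
  have hsq : √(1 / (n : ℝ)) ^ 2 = 1 / n := Real.sq_sqrt (by positivity)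
  have hS : ∑ j : Fin n, q j ^ 2 * (1 / n) ≤ A ^ 2 / m * (3 / (4 * l ^ 2)) := by
    refine (sum_le_of_blockIndices hm hmn k (V := (A / (2 * l)) ^ 2 * (1 / n)) (by positivity)
      (fun j hj ↦ ?_) (fun j ↦ ?_)).trans (le_of_eq ?_)
    · rw [hqb j hj]; simp
    · exact mul_le_mul_of_nonneg_right (hq0 j) (by positivity)
    · field_simp; ring
  have hΓ : ∑ p : Fin n, (q p - q (p - 1)) ^ 2 ≤ A ^ 2 * m / n * (3 * M ^ 2 / (4 * l ^ 2)) := by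
    refine (sum_le_of_blockIndices hm hmn k (V := (A * m * M / (2 * l * n)) ^ 2) (by positivity)
      (fun j hj ↦ ?_) (fun j ↦ hqd j)).trans (le_of_eq ?_)
    · rw [hqb' j hj]; simp
    · field_simp; ring
  have hS0 : 0 ≤ ∑ j : Fin n, q j ^ 2 * (1 / n) := Finset.sum_nonneg fun j _ ↦ by positivity
  refine two_point_obsMap hK (Q := fun i _ ↦ q i * √(1 / n)) hτ.ne' (fun i j ↦ ?_)
    (v := 1 / n) (A := u) (by positivity) (fun p ↦ hsq.ge) (fun i ↦ ?_)
    (α := fun j ↦ q j ^ 2 * (1 / n)) (β := fun _ ↦ 0) (fun j ↦ by positivity) (fun _ ↦ le_rfl)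
    (fun p j ↦ ?_) ?_ hF hG hD
  · simp only [hfac, hq]; ring
  · rw [Real.sq_sqrt (hl.le.trans (le_cubeFun hA θ _))]
    exact (cubeFun_le hA θ _).trans hu
  · rw [mul_pow, hsq, add_zero]
  · simp only [Finset.sum_const_zero, add_zero, ← sub_mul, mul_pow, hsq]
    simp only [Finset.sum_const, Finset.card_univ, Fintype.card_fin, nsmul_eq_mul]
    set S := ∑ j : Fin n, q j ^ 2 * (1 / n)
    have hΓ' : ∑ p : Fin n, (n : ℝ) * ((q p - q (p - 1)) ^ 2 * (1 / n)) ≤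
        A ^ 2 * m / n * (3 * M ^ 2 / (4 * l ^ 2)) := by
      refine le_trans (le_of_eq ?_) hΓ
      refine Finset.sum_congr rfl fun p _ ↦ ?_
      field_simp
    have h1 : S / K ≤ S / √n := by gcongr
    have h2 : (n : ℝ) / √n = √n := Real.div_sqrt
    calc _ ≤ 2 / (1 / (n : ℝ)) * (S / √n + A ^ 2 * m / n * (3 * M ^ 2 / (4 * l ^ 2))) +
          u / τ ^ 2 * (2 * √n * S) := by gcongr
      _ = 2 * S * (n / √n) + A ^ 2 * m * (3 * M ^ 2 / (2 * l ^ 2)) +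
          u / τ ^ 2 * (2 * √n * S) := by field_simp; ring
      _ = S * (√n * (2 + 2 * u / τ ^ 2)) + A ^ 2 * m * (3 * M ^ 2 / (2 * l ^ 2)) := by
          rw [h2]; ring
      _ ≤ A ^ 2 / m * (3 / (4 * l ^ 2)) * (√n * (2 + 2 * u / τ ^ 2)) +
          A ^ 2 * m * (3 * M ^ 2 / (2 * l ^ 2)) := by gcongr
      _ = A ^ 2 * √n / m * (3 / (4 * l ^ 2) * (2 + 2 * u / τ ^ 2)) +
          A ^ 2 * m * (3 * M ^ 2 / (2 * l ^ 2)) := by ring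
      _ ≤ 1 := hle

end Neighbours

end VolatilityModel

namespace VolatilityModel

/-! ### Assouad's lemma and the lower bound -/

section Assouad

/-- Superadditivity of the lower integral requires no measurability, and the loss as a function of
`ω` is not known to be measurable. -/
theorem sum_lintegral_le_lintegral_sum {Ω ι : Type*} [MeasurableSpace Ω] (P : Measure Ω)
    (s : Finset ι) (F : ι → Ω → ℝ≥0∞) :
    ∑ i ∈ s, ∫⁻ ω, F i ω ∂P ≤ ∫⁻ ω, ∑ i ∈ s, F i ω ∂P := by
  classical
  induction s using Finset.induction_on with
  | empty => simp
  | insert a s ha ih =>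
    simp only [Finset.sum_insert ha]
    exact (add_le_add le_rfl ih).trans (le_lintegral_add _ _)

/-- Parallelogram law: the sum of the squares is smallest at the midpoint. -/
theorem ofReal_sq_sub_div_two_le (x a b : ℝ) :
    ENNReal.ofReal ((a - b) ^ 2 / 2) ≤
      ENNReal.ofReal ((x - a) ^ 2) + ENNReal.ofReal ((x - b) ^ 2) := by
  rw [← ENNReal.ofReal_add (sq_nonneg _) (sq_nonneg _)]
  refine ENNReal.ofReal_le_ofReal ?_
  nlinarith [sq_nonneg ((x - a) + (x - b))]

/-- The middle half of `(k/m, (k+1)/m)`. -/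
def middle (m k : ℕ) : Set ℝ := Ioc ((k + 1 / 4) / m : ℝ) ((k + 3 / 4) / m)

theorem measurableSet_middle (m k : ℕ) : MeasurableSet (middle m k) := measurableSet_Ioc

theorem mem_middle_iff {m k : ℕ} (hm : 0 < m) {t : ℝ} :
    t ∈ middle m k ↔ (m : ℝ) * t - k ∈ Ioc (1 / 4 : ℝ) (3 / 4) := by
  have hm' : (0 : ℝ) < m := by exact_mod_cast hm
  rw [middle, mem_Ioc, mem_Ioc, div_lt_iff₀ hm', le_div_iff₀ hm']
  constructor <;> rintro ⟨h1, h2⟩ <;> constructor <;> linarith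

/-- The squared loss on the middle half of `(k/m, (k+1)/m)`. -/
noncomputable def middleLoss (m k : ℕ) (g f : ℝ → ℝ) : ℝ≥0∞ :=
  ∫⁻ t in middle m k, ENNReal.ofReal ((g t - f t) ^ 2)

theorem sum_middleLoss_le_sqLoss {m : ℕ} (hm : 0 < m) (g f : ℝ → ℝ) :
    ∑ k : Fin m, middleLoss m k g f ≤ sqLoss g f := by
  have hm' : (0 : ℝ) < m := by exact_mod_cast hm
  have hdis : Pairwise (Function.onFun Disjoint fun k : Fin m ↦ middle m k) := by
    intro i j hij
    refine Set.disjoint_left.2 fun t hi hj ↦ hij ?_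
    rw [mem_middle_iff hm] at hi hj
    have h1 : ((i : ℕ) : ℝ) < (j : ℕ) + 1 := by linarith [hi.1, hj.2]
    have h2 : ((j : ℕ) : ℝ) < (i : ℕ) + 1 := by linarith [hi.2, hj.1]
    have h1' : (i : ℕ) < j + 1 := by exact_mod_cast h1
    have h2' : (j : ℕ) < i + 1 := by exact_mod_cast h2
    exact Fin.ext (by omega)
  have hsub : (⋃ k : Fin m, middle m k) ⊆ Icc (0 : ℝ) 1 := by
    refine iUnion_subset fun k t ht ↦ ?_
    rw [mem_middle_iff hm] at ht
    have hk : ((k : ℕ) : ℝ) + 1 ≤ m := by exact_mod_cast k.2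
    have hk0 : (0 : ℝ) ≤ (k : ℕ) := by positivity
    have h1 : 0 < (m : ℝ) * t := by linarith [ht.1]
    have h2 : (m : ℝ) * t ≤ m * 1 := by linarith [ht.2]
    exact ⟨(pos_of_mul_pos_right h1 hm'.le).le, le_of_mul_le_mul_left h2 hm'⟩
  unfold middleLoss sqLoss
  rw [← tsum_fintype (L := .unconditional _), ← lintegral_iUnion
    (fun k : Fin m ↦ measurableSet_middle m k) hdis]
  exact lintegral_mono_set hsub

/-- The two functions differ by at least `A δ` on a set of length `1/(2m)`. -/
theorem le_middleLoss_add {m : ℕ} (hm : 0 < m) {δ : ℝ} (hδ0 : 0 ≤ δ)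
    (hδ : ∀ x ∈ Icc (1 / 4 : ℝ) (3 / 4), δ ≤ unitBump x) {l A : ℝ} (hA : 0 ≤ A)
    {θ : Fin m → Bool} {k : Fin m} (hk : θ k = false) {g : ℝ → ℝ}
    (hg : Measurable g) :
    ENNReal.ofReal ((A * δ) ^ 2 / (4 * m)) ≤ middleLoss m k g (cubeFun l A θ) +
      middleLoss m k g (cubeFun l A (Function.update θ k true)) := by
  have hm' : (0 : ℝ) < m := by exact_mod_cast hm
  have hc : Measurable (cubeFun l A θ) := (contDiff_cubeFun l A θ (k := 0)).continuous.measurable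
  unfold middleLoss
  rw [← lintegral_add_left (by fun_prop)]
  have h : ∀ t ∈ middle m k, ENNReal.ofReal ((A * δ) ^ 2 / 2) ≤
      ENNReal.ofReal ((g t - cubeFun l A θ t) ^ 2) +
        ENNReal.ofReal ((g t - cubeFun l A (Function.update θ k true) t) ^ 2) := by
    intro t ht
    refine le_trans ?_ (ofReal_sq_sub_div_two_le _ _ _)
    rw [cubeFun_update hk]
    have ht' := (mem_middle_iff hm).1 ht
    have h1 : A * δ ≤ cubeBump A m k t :=
      mul_le_mul_of_nonneg_left (hδ _ ⟨ht'.1.le, ht'.2⟩) hA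
    have h2 : 0 ≤ A * δ := by positivity
    refine ENNReal.ofReal_le_ofReal ?_
    rw [show cubeFun l A θ t - (cubeFun l A θ t + cubeBump A m k t) = -cubeBump A m k t by ring,
      neg_sq]
    gcongr
  refine le_trans ?_ (setLIntegral_mono' (measurableSet_middle m k) h)
  rw [setLIntegral_const, middle, Real.volume_Ioc, ← ENNReal.ofReal_mul (by positivity)]
  refine ENNReal.ofReal_le_ofReal (le_of_eq ?_)
  field_simp; ring

/-- Flipping the `k`-th bit is an involution of the cube, so the sum can be taken over neighbouring
pairs. -/
theorem card_mul_le_two_mul_sum {m : ℕ} (k : Fin m) {a : (Fin m → Bool) → ℝ≥0∞} {D : ℝ≥0∞}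
    (h : ∀ θ, θ k = false → D ≤ a θ + a (Function.update θ k true)) :
    2 ^ m * D ≤ 2 * ∑ θ, a θ := by
  have hflip : ∑ θ : Fin m → Bool, a (Function.update θ k (!θ k)) = ∑ θ, a θ := by
    have hinv : Function.Involutive fun θ : Fin m → Bool ↦ Function.update θ k (!θ k) := by
      intro θ; simp
    exact Equiv.sum_comp hinv.toPerm a
  rw [two_mul]
  nth_rw 2 [← hflip]
  rw [← Finset.sum_add_distrib]
  have hD : ∀ θ : Fin m → Bool, D ≤ a θ + a (Function.update θ k (!θ k)) := by
    intro θ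
    cases hθ : θ k with
    | false => simpa using h θ hθ
    | true =>
      have := h (Function.update θ k false) (by simp)
      rw [Function.update_idem, ← hθ, Function.update_eq_self, add_comm] at this
      simpa [hθ] using this
  refine le_trans (le_of_eq ?_) (Finset.sum_le_sum fun θ _ ↦ hD θ)
  simp

/-- Assouad's lemma for the hypercube of perturbed functions. -/
theorem le_minimaxRisk_of_two_point {Ω : Type*} [MeasurableSpace Ω] {P : Measure Ω} {n m : ℕ}
    (hm : 0 < m) {Y : (ℝ → ℝ) → Ω → Fin n → ℝ} {S : Set (ℝ → ℝ)} {l A δ r : ℝ} (hA : 0 ≤ A)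
    (hr : 0 ≤ r) (hδ0 : 0 ≤ δ) (hδ : ∀ x ∈ Icc (1 / 4 : ℝ) (3 / 4), δ ≤ unitBump x)
    (hS : ∀ θ : Fin m → Bool, cubeFun l A θ ∈ S)
    (hY : ∀ (θ : Fin m → Bool) (k : Fin m), θ k = false → ∀ F G : (Fin n → ℝ) → ℝ≥0∞,
      Measurable F → Measurable G → ∀ D : ℝ≥0∞, (∀ y, D ≤ F y + G y) →
      D * ENNReal.ofReal (1 / 4) ≤ ∫⁻ ω, F (Y (cubeFun l A θ) ω) ∂P +
        ∫⁻ ω, G (Y (cubeFun l A (Function.update θ k true)) ω) ∂P) :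
    ENNReal.ofReal (r * A ^ 2 * (δ ^ 2 / 32)) ≤ minimaxRisk P r S Y := by
  have hm' : (0 : ℝ) < m := by exact_mod_cast hm
  refine le_iInf₂ fun T hT ↦ ?_
  set R := ⨆ f ∈ S, ∫⁻ ω, ENNReal.ofReal r * sqLoss (T (Y f ω)) f ∂P with hR
  set J : Fin m → (Fin m → Bool) → ℝ≥0∞ := fun k θ ↦
    ∫⁻ ω, middleLoss m k (T (Y (cubeFun l A θ) ω)) (cubeFun l A θ) ∂P with hJ
  have hRθ : ∀ θ : Fin m → Bool, ENNReal.ofReal r * ∑ k, J k θ ≤ R := by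
    intro θ
    refine le_trans ?_ (le_iSup₂ (f := fun f (_ : f ∈ S) ↦
      ∫⁻ ω, ENNReal.ofReal r * sqLoss (T (Y f ω)) f ∂P) _ (hS θ))
    rw [lintegral_const_mul' _ _ ENNReal.ofReal_ne_top]
    refine mul_le_mul_right ?_ _
    exact (sum_lintegral_le_lintegral_sum P _ _).trans
      (lintegral_mono fun ω ↦ sum_middleLoss_le_sqLoss hm _ _)
  -- Joint measurability of the estimator makes the local loss a measurable function of the data, as
  -- the two-point bound requires.
  have hmeas : ∀ (k : Fin m) (θ : Fin m → Bool),
      Measurable fun y ↦ middleLoss m k (T y) (cubeFun l A θ) := by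
    intro k θ
    have hc : Measurable (cubeFun l A θ) := (contDiff_cubeFun l A θ (k := 0)).continuous.measurable
    have h : Measurable fun p : (Fin n → ℝ) × ℝ ↦
        ENNReal.ofReal ((T p.1 p.2 - cubeFun l A θ p.2) ^ 2) := by
      have hT' : Measurable fun p : (Fin n → ℝ) × ℝ ↦ T p.1 p.2 := hT
      fun_prop
    exact h.lintegral_prod_right'
  set D := ENNReal.ofReal ((A * δ) ^ 2 / (4 * m)) with hD
  have hk : ∀ k : Fin m, 2 ^ m * (D * ENNReal.ofReal (1 / 4)) ≤ 2 * ∑ θ, J k θ := fun k ↦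
    card_mul_le_two_mul_sum k fun θ hθ ↦ hY θ k hθ _ _ (hmeas k θ) (hmeas k _) D
      fun y ↦ le_middleLoss_add hm hδ0 hδ hA hθ (hT.of_uncurry_left (x := y))
  -- The supremum dominates the average over the `2^m` vertices.
  have hsum : 2 ^ m * (ENNReal.ofReal r * (m * (D * ENNReal.ofReal (1 / 4)))) ≤
      2 ^ m * (2 * R) := by
    calc 2 ^ m * (ENNReal.ofReal r * (m * (D * ENNReal.ofReal (1 / 4))))
        = ENNReal.ofReal r * ∑ k : Fin m, 2 ^ m * (D * ENNReal.ofReal (1 / 4)) := by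
          simp; ring
      _ ≤ ENNReal.ofReal r * ∑ k : Fin m, 2 * ∑ θ, J k θ := by
          exact mul_le_mul_right (Finset.sum_le_sum fun k _ ↦ hk k) _
      _ = 2 * ∑ θ, ENNReal.ofReal r * ∑ k, J k θ := by
          rw [← Finset.mul_sum, ← Finset.mul_sum, Finset.sum_comm]; ring
      _ ≤ 2 * ∑ _θ : Fin m → Bool, R := by gcongr with θ; exact hRθ θ
      _ = 2 ^ m * (2 * R) := by simp; ring
  have h2 : (2 : ℝ≥0∞) ^ m ≠ 0 := by simp
  have h2' : (2 : ℝ≥0∞) ^ m ≠ ∞ := by simp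
  have h3 := (ENNReal.mul_le_mul_iff_right h2 h2').1 hsum
  have h4 : ENNReal.ofReal r * (m * (D * ENNReal.ofReal (1 / 4))) =
      2 * ENNReal.ofReal (r * A ^ 2 * (δ ^ 2 / 32)) := by
    rw [hD, ← ENNReal.ofReal_natCast, ← ENNReal.ofReal_mul (by positivity),
      ← ENNReal.ofReal_mul (by positivity), ← ENNReal.ofReal_mul hr,
      show (2 : ℝ≥0∞) = ENNReal.ofReal 2 by simp, ← ENNReal.ofReal_mul (by norm_num)]
    congr 1
    field_simp; ring
  rw [h4] at h3
  exact (ENNReal.mul_le_mul_iff_right two_ne_zero ENNReal.ofNat_ne_top).1 h3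

end Assouad

/-! ### Choice of the number of bumps, the ramp length and the amplitude. -/

section Rates

/-- Take `m = ⌈x⌉` with `x = n^(1/(4α+2))`. Then `√n = x^(2α+1)` and the normalising rate is
`x^(2α)`; rounding costs `m ≤ 2x`, hence the factor `2^(-2α)`. -/
theorem exists_bandwidth {α : ℝ} (hα : 1 / 2 ≤ α) {n : ℕ} (hn : 0 < n) :
    ∃ m : ℕ, 0 < m ∧ m ≤ n ∧ ((m : ℝ) ^ (-α)) ^ 2 * √n / m ≤ 1 ∧ ((m : ℝ) ^ (-α)) ^ 2 * m ≤ 1 ∧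
      (2 : ℝ) ^ (-(2 * α)) ≤ (n : ℝ) ^ (α / (2 * α + 1)) * ((m : ℝ) ^ (-α)) ^ 2 := by
  have hn' : (0 : ℝ) < n := by exact_mod_cast hn
  have hn1 : (1 : ℝ) ≤ n := by exact_mod_cast hn
  set x : ℝ := (n : ℝ) ^ (1 / (4 * α + 2)) with hx
  have hx1 : 1 ≤ x := Real.one_le_rpow hn1 (by positivity)
  have hxn : x ≤ n := by
    calc x ≤ (n : ℝ) ^ (1 : ℝ) := by
          refine Real.rpow_le_rpow_of_exponent_le hn1 ?_
          rw [div_le_one (by linarith)]; linarith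
      _ = n := Real.rpow_one _
  have hm0 : 0 < ⌈x⌉₊ := Nat.ceil_pos.2 (by linarith)
  have hm' : (0 : ℝ) < ⌈x⌉₊ := by exact_mod_cast hm0
  have hm1 : (1 : ℝ) ≤ ⌈x⌉₊ := by exact_mod_cast hm0
  have hxm : x ≤ ⌈x⌉₊ := Nat.le_ceil x
  have hm2 : (⌈x⌉₊ : ℝ) ≤ 2 * x := by linarith [Nat.ceil_lt_add_one (by linarith : 0 ≤ x)]
  have hsq : ((⌈x⌉₊ : ℝ) ^ (-α)) ^ 2 = (⌈x⌉₊ : ℝ) ^ (-(2 * α)) := by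
    rw [← Real.rpow_natCast, ← Real.rpow_mul hm'.le]; congr 1; push_cast; ring
  refine ⟨⌈x⌉₊, hm0, Nat.ceil_le.2 hxn, ?_, ?_, ?_⟩
  · have h1 : √(n : ℝ) = x ^ (2 * α + 1) := by
      rw [hx, ← Real.rpow_mul hn'.le, Real.sqrt_eq_rpow]
      congr 1
      field_simp; ring
    have h2 : x ^ (2 * α + 1) ≤ (⌈x⌉₊ : ℝ) ^ (2 * α + 1) :=
      Real.rpow_le_rpow (by linarith) hxm (by linarith)
    rw [hsq, h1, div_le_one hm']
    calc (⌈x⌉₊ : ℝ) ^ (-(2 * α)) * x ^ (2 * α + 1) ≤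
          (⌈x⌉₊ : ℝ) ^ (-(2 * α)) * (⌈x⌉₊ : ℝ) ^ (2 * α + 1) := by gcongr
      _ = ⌈x⌉₊ := by rw [← Real.rpow_add hm']; simp
  · rw [hsq]
    nth_rw 2 [← Real.rpow_one (⌈x⌉₊ : ℝ)]
    rw [← Real.rpow_add hm']
    exact Real.rpow_le_one_of_one_le_of_nonpos hm1 (by linarith)
  · have h1 : (n : ℝ) ^ (α / (2 * α + 1)) = x ^ (2 * α) := by
      rw [hx, ← Real.rpow_mul hn'.le]
      congr 1
      field_simp; ring
    have h2 : (2 * x) ^ (-(2 * α)) ≤ (⌈x⌉₊ : ℝ) ^ (-(2 * α)) :=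
      Real.rpow_le_rpow_of_nonpos hm' hm2 (by linarith)
    rw [hsq, h1]
    calc (2 : ℝ) ^ (-(2 * α)) = x ^ (2 * α) * (2 * x) ^ (-(2 * α)) := by
          rw [Real.mul_rpow (by norm_num) (by linarith), Real.rpow_neg (by linarith : 0 ≤ x)]
          have : x ^ (2 * α) ≠ 0 := (Real.rpow_pos_of_pos (by linarith) _).ne'
          field_simp
      _ ≤ _ := by gcongr

theorem sqrt_le_ceil_le {n : ℕ} (hn : 0 < n) :
    √(n : ℝ) ≤ (⌈√(n : ℝ)⌉₊ : ℝ) ∧ (⌈√(n : ℝ)⌉₊ : ℝ) ≤ 2 * √n := by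
  have h1 : 1 ≤ √(n : ℝ) := Real.one_le_sqrt.2 (by exact_mod_cast hn)
  exact ⟨Nat.le_ceil _, by linarith [Nat.ceil_lt_add_one (Real.sqrt_nonneg (n : ℝ))]⟩

theorem exists_pos_sq_mul_le {c₀ : ℝ} (hc₀ : 0 < c₀) (B : ℝ) : ∃ c > 0, c ≤ c₀ ∧ c ^ 2 * B ≤ 1 := by
  refine ⟨min (min c₀ 1) (1 / (|B| + 1)), by positivity,
    (min_le_left _ _).trans (min_le_left _ _), ?_⟩
  set c := min (min c₀ 1) (1 / (|B| + 1))
  have h0 : 0 < c := by positivity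
  have h1 : c ≤ 1 := (min_le_left _ _).trans (min_le_right _ _)
  have h2 : c * (|B| + 1) ≤ 1 := by
    rw [← le_div_iff₀ (by positivity)]; exact min_le_right _ _
  have h3 : c ^ 2 ≤ c := by nlinarith
  calc c ^ 2 * B ≤ c ^ 2 * (|B| + 1) := by gcongr; linarith [le_abs_self B]
    _ ≤ c * (|B| + 1) := by gcongr
    _ ≤ 1 := h2

end Rates

end VolatilityModel

/-! ### The lower bound in both models. -/

theorem mainTheorem2 (α L l u τ : ℝ) (hL : 0 < L) (hl : 0 < l) (hlu : l < u) (hτ : 0 < τ) :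
    ∃ C : ℝ, 0 < C ∧
      ∀ {Ω : Type*} [MeasurableSpace Ω] (P : Measure Ω) [IsProbabilityMeasure P]
        (W : ℝ≥0 → Ω → ℝ) (ε : (n : ℕ) → Fin n → Ω → ℝ),
        IsBrownianReal W P →
        (∀ n i, HasLaw (ε n i) (gaussianReal 0 1) P) →
        (∀ n, iIndepFun (ε n) P) →
        (∀ n, IndepFun (fun ω t ↦ W t ω) (fun ω i ↦ ε n i ω) P) →
        (1 / 2 < α →
          ENNReal.ofReal C ≤ liminf (fun n : ℕ ↦
            VolatilityModel.minimaxRisk P ((n : ℝ) ^ (α / (2 * α + 1)))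
              (VolatilityModel.boundedHolder α L l u)
              (VolatilityModel.obsIntegral P W τ (ε n))) atTop) ∧
        (1 ≤ α →
          ENNReal.ofReal C ≤ liminf (fun n : ℕ ↦
            VolatilityModel.minimaxRisk P ((n : ℝ) ^ (α / (2 * α + 1)))
              (VolatilityModel.boundedHolder α L l u)
              (VolatilityModel.obsProduct W τ (ε n))) atTop) := by
  open VolatilityModel in
  rcases le_or_gt α (1 / 2) with hα | hα
  -- Both claims are vacuous for `α ≤ 1/2`.
  · refine ⟨1, one_pos, fun P _ W ε _ _ _ _ ↦ ⟨fun h ↦ ?_, fun h ↦ ?_⟩⟩ <;> linarith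
  obtain ⟨c₀, hc₀, hmem⟩ := exists_cubeFun_mem_boundedHolder (α := α) (by linarith) hL hlu
  obtain ⟨δ, hδ0, hδ⟩ := exists_le_unitBump
  obtain ⟨M, hM0, hM⟩ := exists_lipschitz_cubeBump
  have hu : 0 < u := hl.trans hlu
  set B₁ := 3 / (4 * l) * (2 / l + 2 / τ ^ 2) with hB₁
  set B₂ := 3 / (4 * l ^ 2) * (2 + 2 * u / τ ^ 2) with hB₂
  set B₃ := 3 * M ^ 2 / (2 * l ^ 2) with hB₃
  have hB₁0 : 0 ≤ B₁ := by positivity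
  have hB₂0 : 0 ≤ B₂ := by positivity
  have hB₃0 : 0 ≤ B₃ := by positivity
  -- One amplitude for both models: `c₀` keeps the cube in the class, `u - l` gives `l + A ≤ u`, and
  -- `B₁ + B₂ + B₃` bounds the excess in each two-point comparison by one.
  obtain ⟨c, hc, hcc₀, hcB⟩ :=
    exists_pos_sq_mul_le (lt_min hc₀ (by linarith : 0 < u - l)) (B₁ + B₂ + B₃)
  refine ⟨c ^ 2 * 2 ^ (-(2 * α)) * (δ ^ 2 / 32), by positivity, ?_⟩
  intro Ω _ P _ W ε hWB hε hi hind
  have hW : IsPreBrownianReal W P := hWB.toIsPreBrownianReal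
  have hrate : ∀ {n m : ℕ}, (2 : ℝ) ^ (-(2 * α)) ≤
      (n : ℝ) ^ (α / (2 * α + 1)) * ((m : ℝ) ^ (-α)) ^ 2 →
      ENNReal.ofReal (c ^ 2 * 2 ^ (-(2 * α)) * (δ ^ 2 / 32)) ≤
        ENNReal.ofReal ((n : ℝ) ^ (α / (2 * α + 1)) * (c * (m : ℝ) ^ (-α)) ^ 2 *
          (δ ^ 2 / 32)) := fun {n m} h ↦ by
    refine ENNReal.ofReal_le_ofReal ?_
    calc _ ≤ c ^ 2 * ((n : ℝ) ^ (α / (2 * α + 1)) * ((m : ℝ) ^ (-α)) ^ 2) * (δ ^ 2 / 32) := by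
          gcongr
      _ = _ := by ring
  have hc1 : c ≤ c₀ := hcc₀.trans (min_le_left _ _)
  have hc2 : l + c ≤ u := by linarith [hcc₀.trans (min_le_right _ _)]
  constructor
  · intro _
    refine le_liminf_of_le (by isBoundedDefault) ?_
    filter_upwards [eventually_gt_atTop 0] with n hn
    obtain ⟨m, hm, hmn, h1, -, h3⟩ := exists_bandwidth hα.le hn
    obtain ⟨hK0, hK1⟩ := sqrt_le_ceil_le hn
    have hA : 0 ≤ c * (m : ℝ) ^ (-α) := by positivity
    refine (hrate h3).trans (le_minimaxRisk_of_two_point hm hA (by positivity) hδ0.le hδ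
      (hmem c hc.le hc1 m hm) fun θ k hk F G hF hG D hD ↦ ?_)
    refine two_point_obsIntegral hW hm hmn hK0 hK1 hl hA hτ ?_ hk (hε n) (hi n) (hind n) hF hG hD
    calc (c * (m : ℝ) ^ (-α)) ^ 2 * √n / m * B₁
        = c ^ 2 * B₁ * (((m : ℝ) ^ (-α)) ^ 2 * √n / m) := by ring
      _ ≤ c ^ 2 * B₁ * 1 := by gcongr
      _ ≤ c ^ 2 * (B₁ + B₂ + B₃) := by rw [mul_one]; gcongr; linarith
      _ ≤ 1 := hcB
  · intro _
    refine le_liminf_of_le (by isBoundedDefault) ?_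
    filter_upwards [eventually_gt_atTop 0] with n hn
    obtain ⟨m, hm, hmn, h1, h2, h3⟩ := exists_bandwidth hα.le hn
    obtain ⟨hK0, hK1⟩ := sqrt_le_ceil_le hn
    have hm1 : (1 : ℝ) ≤ m := by exact_mod_cast hm
    have hA : 0 ≤ c * (m : ℝ) ^ (-α) := by positivity
    have hAc : c * (m : ℝ) ^ (-α) ≤ c :=
      mul_le_of_le_one_right hc.le (Real.rpow_le_one_of_one_le_of_nonpos hm1 (by linarith))
    refine (hrate h3).trans (le_minimaxRisk_of_two_point hm hA (by positivity) hδ0.le hδ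
      (hmem c hc.le hc1 m hm) fun θ k hk F G hF hG D hD ↦ ?_)
    refine two_point_obsProduct hW hm hmn hK0 hK1 hl hA hτ hM0.le (hM _ hA m)
      (u := u) (by linarith) ?_ hk (hε n) (hi n) (hind n) hF hG hD
    calc (c * (m : ℝ) ^ (-α)) ^ 2 * √n / m * B₂ + (c * (m : ℝ) ^ (-α)) ^ 2 * m * B₃
        = c ^ 2 * B₂ * (((m : ℝ) ^ (-α)) ^ 2 * √n / m) +
          c ^ 2 * B₃ * (((m : ℝ) ^ (-α)) ^ 2 * m) := by ring
      _ ≤ c ^ 2 * B₂ * 1 + c ^ 2 * B₃ * 1 := by gcongr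
      _ = c ^ 2 * (B₂ + B₃) := by ring
      _ ≤ c ^ 2 * (B₁ + B₂ + B₃) := by gcongr; linarith
      _ ≤ 1 := hcB
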